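/- Let $N\ge 1$, let $\Omega\subseteq\mathbb R^N$ be a bounded domain with $C^2$-boundary, $1<p<\infty$, $\sigma$ the $(N-1)$-dimensional Hausdorff measure on $\partial\Omega$, and let $W^{1,p}(\Omega)$ carry the norm $\|u\|=(\|u\|_p^p+\|Du\|_p^p)^{1/p}$. Let $\beta\in C^{0,\alpha}(\partial\Omega)$ for some $\alpha\in(0,1)$, with $\beta(z)>0$ for all $z\in\partial\Omega$, and put $$\tau(u)=\|Du\|_p^p+\int_{\partial\Omega}\beta(z)|u|^p\,d\sigma,\qquad u\in W^{1,p}(\Omega),$$ where boundary values are understood in the sense of traces. Let $\hat\lambda_1<\hat\lambda_2<\cdots$ be the strictly increasing sequence of the distinct variational eigenvalues of the Robin $p$-Laplacian $$-\Delta_pu=\hat\lambda|u|^{p-2}u\ \text{ in }\Omega,\qquad \tfrac{\partial u}{\partial n_p}+\beta(z)|u|^{p-2}u=0\ \text{ on }\partial\Omega,$$ that is, of the distinct values among $\inf\{\sup_{u\in A}\tau(u): A\subseteq\{u\in W^{1,p}(\Omega):\|u\|_p=1\}\text{ closed and symmetric},\ \operatorname{ind}(A)\ge k\}$, $k\ge1$,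 where $\operatorname{ind}$ is the Fadell--Rabinowitz $\mathbb Z_2$-cohomological index. Let $1<q<p$. Let $g:\Omega\times\mathbb R\to\mathbb R$ be a Carath\'eodory function with $g(z,0)=0$ for a.a. $z\in\Omega$ such that (i) for every $\rho>0$ there is $a_\rho\in L^\infty(\Omega)$ with $|g(z,x)|\le a_\rho(z)$ for a.a. $z\in\Omega$ and all $|x|\le\rho$; and $g(z,x)x>0$ for a.a. $z\in\Omega$ and all $x\ne0$; (ii) $\lim_{x\to0}\frac{g(z,x)}{|x|^{p-2}x}=0$ and $\lim_{x\to\pm\infty}\frac{g(z,x)}{|x|^{q-2}x}=0$, uniformly for a.a. $z\in\Omega$. Let $f:\Omega\times\mathbb R\to\mathbb R$ be a Carath\'eodory function with $f(z,0)=0$ for a.a. $z\in\Omega$ such that (i) for every $\rho>0$ there is $\hat a_\rho\in L^\infty(\Omega)$ with $|f(z,x)|\le\hat a_\rho(z)$ for a.a. $z\in\Omega$ and all $|x|\le\rho$; (ii) $\lim_{x\to\pm\infty}\frac{f(z,x)}{|x|^{p-2}x}=\hat\lambda_m$ uniformly for a.a. $z\in\Omega$, for some integer $m\ge2$, and, with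 $F(z,x)=\int_0^xf(z,s)\,ds$, $\liminf_{x\to\pm\infty}\frac{pF(z,x)-f(z,x)x}{|x|^q}>0$ uniformly for a.a. $z\in\Omega$; (iii) there is $\vartheta\in L^\infty(\Omega)$ with $\vartheta(z)\le\hat\lambda_1$ for a.a. $z\in\Omega$, $\vartheta\not\equiv\hat\lambda_1$, and $\limsup_{x\to0}\frac{f(z,x)}{|x|^{p-2}x}\le\vartheta(z)$ uniformly for a.a. $z\in\Omega$. Then for every $\lambda>0$ the functional $$\varphi_\lambda(u)=\frac1p\tau(u)-\lambda\int_\Omega G(z,u)\,dz-\int_\Omega F(z,u)\,dz,\qquad u\in W^{1,p}(\Omega),\quad G(z,x)=\int_0^xg(z,s)\,ds,$$ satisfies the Cerami condition: $\varphi_\lambda\in C^1(W^{1,p}(\Omega),\mathbb R)$, and every sequence $(u_n)$ in $W^{1,p}(\Omega)$ such that $(\varphi_\lambda(u_n))$ is bounded and $(1+\|u_n\|)\varphi_\lambda'(u_n)\to0$ in $W^{1,p}(\Omega)^*$ has a strongly convergent subsequence. -/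

import Mathlib

open MeasureTheory Filter Topology
open scoped ENNReal NNReal ContDiff

namespace RobinResonant

/-! ### The Cerami condition -/

/-- A functional `φ` on a real normed space satisfies the Cerami condition: it is of class `C¹`, and
every sequence along which `φ` is bounded and `(1 + ‖uₙ‖) φ'(uₙ) → 0` in the dual has a
norm-convergent subsequence. -/
def CeramiCondition {X : Type*} [NormedAddCommGroup X] [NormedSpace ℝ X] (φ : X → ℝ) : Prop :=
  ContDiff ℝ 1 φ ∧
    ∀ u : ℕ → X, (∃ M : ℝ, ∀ n, |φ (u n)| ≤ M) →
      Tendsto (fun n => (1 + ‖u n‖) • fderiv ℝ φ (u n)) atTop (𝓝 0) →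
      ∃ k : ℕ → ℕ, StrictMono k ∧ ∃ x : X, Tendsto (fun n => u (k n)) atTop (𝓝 x)

/-! ### The domain -/

/-- Euclidean space `ℝᴺ`. -/
abbrev Euc (N : ℕ) : Type := EuclideanSpace ℝ (Fin N)

/-- `Ω` has a `C²` boundary: near each boundary point there is a direction `ν` such that `Ω` is the
region strictly above the graph (in direction `ν`, over the hyperplane orthogonal to `ν`)
of a `C²` function. -/
def HasC2Boundary {N : ℕ} (Ω : Set (Euc N)) : Prop :=
  ∀ x₀ ∈ frontier Ω, ∃ ν : Euc N, ‖ν‖ = 1 ∧ ∃ γ : Euc N → ℝ, ContDiff ℝ 2 γ ∧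
    ∃ U ∈ 𝓝 x₀, ∀ x ∈ U, (x ∈ Ω ↔ γ (x - (inner ℝ ν x) • ν) < inner ℝ ν x)

/-- Lebesgue measure on `Ω`. -/
noncomputable abbrev vol {N : ℕ} (Ω : Set (Euc N)) : Measure (Euc N) := volume.restrict Ω

/-- Surface measure on `∂Ω`: the `(N-1)`-dimensional Hausdorff measure (normalized so that it is
Lebesgue measure on hyperplanes), restricted to `∂Ω`. -/
noncomputable abbrev surf {N : ℕ} (Ω : Set (Euc N)) : Measure (Euc N) :=
  (Measure.euclideanHausdorffMeasure (N - 1)).restrict (frontier Ω)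

/-! ### The Sobolev space -/

instance factOneLe {p : ℝ} [hp : Fact (1 < p)] : Fact (1 ≤ ENNReal.ofReal p) :=
  ⟨ENNReal.one_le_ofReal.2 hp.out.le⟩

/-- `v` is the weak gradient of `u` on `Ω`. -/
def IsWeakGradient {N : ℕ} (Ω : Set (Euc N)) (u : Euc N → ℝ) (v : Euc N → Euc N) : Prop :=
  ∀ φ : Euc N → ℝ, ContDiff ℝ ∞ φ → HasCompactSupport φ → tsupport φ ⊆ Ω → ∀ e : Euc N,
    ∫ z in Ω, u z * fderiv ℝ φ z e = - ∫ z in Ω, inner ℝ (v z) e * φ z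

theorem integrable_mul_test {N : ℕ} {Ω : Set (Euc N)} {p : ℝ} [Fact (1 < p)]
    {u ψ : Euc N → ℝ} (hu : MemLp u (ENNReal.ofReal p) (vol Ω))
    (hψ : Continuous ψ) (hc : HasCompactSupport ψ) :
    Integrable (fun z => u z * ψ z) (vol Ω) := by
  have h1 : MemLp ψ (ENNReal.conjExponent (ENNReal.ofReal p)) (vol Ω) :=
    hψ.memLp_of_hasCompactSupport hc
  have : ENNReal.HolderConjugate (ENNReal.ofReal p)
      (ENNReal.conjExponent (ENNReal.ofReal p)) :=
    ENNReal.HolderConjugate.conjExponent (factOneLe (p := p)).out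
  exact hu.integrable_mul h1

theorem integrable_test₁ {N : ℕ} {Ω : Set (Euc N)} {p : ℝ} [Fact (1 < p)]
    {u φ : Euc N → ℝ} (hu : MemLp u (ENNReal.ofReal p) (vol Ω))
    (hφ : ContDiff ℝ ∞ φ) (hc : HasCompactSupport φ) (e : Euc N) :
    Integrable (fun z => u z * fderiv ℝ φ z e) (vol Ω) :=
  integrable_mul_test hu ((hφ.continuous_fderiv (by simp)).clm_apply continuous_const)
    (hc.fderiv_apply (𝕜 := ℝ) e)

theorem integrable_test₂ {N : ℕ} {Ω : Set (Euc N)} {p : ℝ} [Fact (1 < p)]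
    {v : Euc N → Euc N} {φ : Euc N → ℝ} (hv : MemLp v (ENNReal.ofReal p) (vol Ω))
    (hφ : ContDiff ℝ ∞ φ) (hc : HasCompactSupport φ) (e : Euc N) :
    Integrable (fun z => inner ℝ (v z) e * φ z) (vol Ω) :=
  integrable_mul_test (hv.inner_const e) hφ.continuous hc

/-- The Sobolev space `W^{1,p}(Ω)`, as the space of pairs `(u, Du)` in `Lᵖ(Ω) × Lᵖ(Ω; ℝᴺ)` with
`Du` the weak gradient of `u`. The norm inherited from `WithLp` is
`‖u‖ = (‖u‖ₚ^p + ‖Du‖ₚ^p)^{1/p}`. -/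
def W1p {N : ℕ} (Ω : Set (Euc N)) (p : ℝ) [Fact (1 < p)] :
    Submodule ℝ (WithLp (ENNReal.ofReal p)
      (Lp ℝ (ENNReal.ofReal p) (vol Ω) × Lp (Euc N) (ENNReal.ofReal p) (vol Ω))) where
  carrier := {w | IsWeakGradient Ω w.fst w.snd}
  zero_mem' := by
    intro φ _ _ _ e
    have h1 : ∫ z in Ω, (0 : Lp ℝ (ENNReal.ofReal p) (vol Ω)) z * fderiv ℝ φ z e = 0 := by
      apply integral_eq_zero_of_ae
      filter_upwards [Lp.coeFn_zero ℝ (ENNReal.ofReal p) (vol Ω)] with z hz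
      change _ * _ = (0 : ℝ)
      rw [hz, Pi.zero_apply, zero_mul]
    have h2 : ∫ z in Ω, inner ℝ ((0 : Lp (Euc N) (ENNReal.ofReal p) (vol Ω)) z) e * φ z = 0 := by
      apply integral_eq_zero_of_ae
      filter_upwards [Lp.coeFn_zero (Euc N) (ENNReal.ofReal p) (vol Ω)] with z hz
      change _ * _ = (0 : ℝ)
      rw [hz, Pi.zero_apply, inner_zero_left, zero_mul]
    simp only [WithLp.zero_fst, WithLp.zero_snd]
    rw [h1, h2, neg_zero]
  add_mem' := by
    intro a b ha hb φ hφ hc hs e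
    have h1 : ∫ z in Ω, (a + b).fst z * fderiv ℝ φ z e
        = ∫ z in Ω, (a.fst z * fderiv ℝ φ z e + b.fst z * fderiv ℝ φ z e) := by
      apply integral_congr_ae
      filter_upwards [Lp.coeFn_add a.fst b.fst] with z hz
      simp only [WithLp.add_fst, hz, Pi.add_apply, add_mul]
    have h2 : ∫ z in Ω, inner ℝ ((a + b).snd z) e * φ z
        = ∫ z in Ω, (inner ℝ (a.snd z) e * φ z + inner ℝ (b.snd z) e * φ z) := by
      apply integral_congr_ae
      filter_upwards [Lp.coeFn_add a.snd b.snd] with z hz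
      simp only [WithLp.add_snd, hz, Pi.add_apply, inner_add_left, add_mul]
    rw [h1, h2, integral_add (integrable_test₁ (Lp.memLp _) hφ hc e)
      (integrable_test₁ (Lp.memLp _) hφ hc e),
      integral_add (integrable_test₂ (Lp.memLp _) hφ hc e)
      (integrable_test₂ (Lp.memLp _) hφ hc e), ha φ hφ hc hs e, hb φ hφ hc hs e]
    ring
  smul_mem' := by
    intro c a ha φ hφ hc hs e
    have h1 : ∫ z in Ω, (c • a).fst z * fderiv ℝ φ z e
        = ∫ z in Ω, c * (a.fst z * fderiv ℝ φ z e) := by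
      apply integral_congr_ae
      filter_upwards [Lp.coeFn_smul c a.fst] with z hz
      simp only [WithLp.smul_fst, hz, Pi.smul_apply, smul_eq_mul, mul_assoc]
    have h2 : ∫ z in Ω, inner ℝ ((c • a).snd z) e * φ z
        = ∫ z in Ω, c * (inner ℝ (a.snd z) e * φ z) := by
      apply integral_congr_ae
      filter_upwards [Lp.coeFn_smul c a.snd] with z hz
      simp only [WithLp.smul_snd, hz, Pi.smul_apply, real_inner_smul_left, mul_assoc]
    rw [h1, h2, integral_const_mul, integral_const_mul, ha φ hφ hc hs e]
    ring

variable {N : ℕ} {Ω : Set (Euc N)} {p : ℝ} [Fact (1 < p)]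

/-- The function in `Lᵖ(Ω)` underlying an element of `W^{1,p}(Ω)`. -/
def fn (u : W1p Ω p) : Lp ℝ (ENNReal.ofReal p) (vol Ω) := u.1.fst

/-- The weak gradient of an element of `W^{1,p}(Ω)`. -/
def grad (u : W1p Ω p) : Lp (Euc N) (ENNReal.ofReal p) (vol Ω) := u.1.snd

/-- `γ` is a trace operator: it is the restriction to `∂Ω` on `W^{1,p}(Ω) ∩ C(closure Ω)`. -/
def IsTraceOperator (γ : W1p Ω p →L[ℝ] Lp ℝ (ENNReal.ofReal p) (surf Ω)) : Prop :=
  ∀ (u : W1p Ω p) (v : Euc N → ℝ), ContinuousOn v (closure Ω) →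
    (fn u : Euc N → ℝ) =ᵐ[vol Ω] v → (γ u : Euc N → ℝ) =ᵐ[surf Ω] v

open Classical in
/-- The trace map `W^{1,p}(Ω) → Lᵖ(∂Ω)`: the (unique, for bounded domains with `C²` boundary)
continuous linear map that restricts to `∂Ω` the elements of `W^{1,p}(Ω) ∩ C(closure Ω)`. -/
noncomputable def trace (Ω : Set (Euc N)) (p : ℝ) [Fact (1 < p)] :
    W1p Ω p →L[ℝ] Lp ℝ (ENNReal.ofReal p) (surf Ω) :=
  if h : ∃ γ : W1p Ω p →L[ℝ] Lp ℝ (ENNReal.ofReal p) (surf Ω), IsTraceOperator γ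
  then h.choose else 0

/-- `τ(u) = ‖Du‖ₚ^p + ∫_{∂Ω} β |u|^p dσ`. -/
noncomputable def tau (β : Euc N → ℝ) (u : W1p Ω p) : ℝ :=
  ‖grad u‖ ^ p + ∫ z, β z * |trace Ω p u z| ^ p ∂(surf Ω)

/-! ### The Fadell–Rabinowitz cohomological index

Alexander–Spanier cohomology with coefficients in `ℤ/2`: a cochain is a function on
`B^{n+1}`, and cochains are identified when they differ by a locally zero one. -/

/-- An Alexander–Spanier cochain is locally zero if it vanishes near the diagonal. -/
def LocallyZero {B : Type*} [TopologicalSpace B] {n : ℕ}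
    (φ : (Fin (n + 1) → B) → ZMod 2) : Prop :=
  ∀ b : B, ∃ U ∈ 𝓝 b, ∀ x : Fin (n + 1) → B, (∀ i, x i ∈ U) → φ x = 0

/-- The Alexander–Spanier coboundary (no signs modulo two). -/
def coboundary {B : Type*} {n : ℕ} (ψ : (Fin (n + 1) → B) → ZMod 2) :
    (Fin (n + 2) → B) → ZMod 2 :=
  fun x => ∑ i : Fin (n + 2), ψ (fun j => x (i.succAbove j))

/-- The class of `φ` in the `n`-th Alexander–Spanier cohomology group vanishes: up to a locally zero
cochain, `φ` is a coboundary (and `0` in degree zero). -/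
def IsNullClass {B : Type*} [TopologicalSpace B] :
    (n : ℕ) → ((Fin (n + 1) → B) → ZMod 2) → Prop
  | 0, φ => LocallyZero φ
  | _ + 1, φ => ∃ ψ, LocallyZero (fun x => φ x - coboundary ψ x)

/-- The antipodal equivalence relation on a subset of a vector space. -/
def antipodal {E : Type*} [AddCommGroup E] (A : Set E) : Setoid A where
  r x y := (x : E) = y ∨ (x : E) = -(y : E)
  iseqv := by
    refine ⟨fun x => Or.inl rfl, ?_, ?_⟩
    · rintro x y (h | h)
      · exact Or.inl h.symm
      · exact Or.inr (by rw [h, neg_neg])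
    · rintro x y z (h | h) (h' | h')
      · exact Or.inl (h.trans h')
      · exact Or.inr (h.trans h')
      · exact Or.inr (by rw [h, h'])
      · exact Or.inl (by rw [h, h', neg_neg])

/-- The orbit space `A / {±1}`, with the quotient topology. -/
abbrev Orbit {E : Type*} [NormedAddCommGroup E] (A : Set E) : Type _ := Quotient (antipodal A)

open Classical in
/-- A cocycle representing the characteristic class `w ∈ H¹(A / {±1}; ℤ/2)` of the double covering
`A → A / {±1}` (the pull-back of the generator of `H¹(ℝP^∞; ℤ/2)` under a classifying map), where
`A` is symmetric and `0 ∉ A`. For a set-theoretic section `s` of the covering, its value at two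
nearby orbits is `0` if `s` picks points on the same local sheet, and `1` otherwise. -/
noncomputable def charCocycle {E : Type*} [NormedAddCommGroup E] (A : Set E)
    (b₀ b₁ : Orbit A) : ZMod 2 :=
  if ‖(b₀.out : E) - (b₁.out : E)‖ < ‖(b₀.out : E) + (b₁.out : E)‖ then 0 else 1

/-- The cocycle representing the `n`-fold cup product `w ∪ ⋯ ∪ w`. -/
noncomputable def charPower {E : Type*} [NormedAddCommGroup E] (A : Set E) (n : ℕ) :
    (Fin (n + 1) → Orbit A) → ZMod 2 :=
  fun x => ∏ i : Fin n, charCocycle A (x i.castSucc) (x i.succ)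

/-- The Fadell–Rabinowitz index of a symmetric set `A` with `0 ∉ A`: the least `k` with `w^k = 0`
(equivalently the largest `k` with `w^{k-1} ≠ 0`; it is `0` exactly for `A = ∅`), and `∞` if there is
no such `k`. -/
noncomputable def fadellRabinowitzIndex {E : Type*} [NormedAddCommGroup E] (A : Set E) : ℕ∞ :=
  sInf {k : ℕ∞ | ∃ n : ℕ, k = n ∧ IsNullClass n (charPower A n)}

/-! ### Variational eigenvalues of the Robin `p`-Laplacian -/

/-- The `k`-th minimax value (`k ≥ 1`): the infimum of `sup_{u ∈ A} τ(u)` over the closed symmetric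
subsets `A` of `{u : ‖u‖ₚ = 1}` of index at least `k`. -/
noncomputable def minimaxValue (Ω : Set (Euc N)) (p : ℝ) [Fact (1 < p)] (β : Euc N → ℝ)
    (k : ℕ) : ℝ :=
  sInf {c : ℝ | ∃ A : Set (W1p Ω p), IsClosed A ∧ (∀ u ∈ A, ‖fn u‖ = 1) ∧ (∀ u ∈ A, -u ∈ A) ∧
    (k : ℕ∞) ≤ fadellRabinowitzIndex A ∧ ∀ u ∈ A, tau β u ≤ c}

/-- The strictly increasing sequence `λ̂₁ < λ̂₂ < ⋯` of the distinct minimax values (the value at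
the index `0` is a dummy). -/
noncomputable def variationalEigenvalue (Ω : Set (Euc N)) (p : ℝ) [Fact (1 < p)]
    (β : Euc N → ℝ) : ℕ → ℝ
  | 0 => 0
  | 1 => minimaxValue Ω p β 1
  | m + 2 => sInf {c : ℝ | variationalEigenvalue Ω p β (m + 1) < c ∧
      ∃ k : ℕ, 1 ≤ k ∧ c = minimaxValue Ω p β k}

/-! ### Hypotheses on the data -/

/-- Hypothesis on the boundary coefficient: Hölder continuous and positive on `∂Ω`. -/
def HypBeta (Ω : Set (Euc N)) (β : Euc N → ℝ) : Prop :=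
  (∃ α : ℝ≥0, 0 < α ∧ α < 1 ∧ ∃ C : ℝ≥0, HolderOnWith C α β (frontier Ω)) ∧
    ∀ z ∈ frontier Ω, 0 < β z

/-- Carathéodory function on `Ω × ℝ`. -/
def IsCaratheodory (Ω : Set (Euc N)) (h : Euc N → ℝ → ℝ) : Prop :=
  (∀ x, AEMeasurable (fun z => h z x) (vol Ω)) ∧ ∀ᵐ z ∂(vol Ω), Continuous (h z)

/-- `h` is bounded on bounded sets of `x`, by a bounded function of `z`. -/
def LocallyBounded (Ω : Set (Euc N)) (h : Euc N → ℝ → ℝ) : Prop :=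
  ∀ ρ : ℝ, 0 < ρ → ∃ a : Euc N → ℝ, MemLp a ∞ (vol Ω) ∧
    ∀ᵐ z ∂(vol Ω), ∀ x : ℝ, |x| ≤ ρ → |h z x| ≤ a z

/-- `lim_{x → ±∞} h(z,x) / (|x|^{r-2} x) = L`, uniformly for almost all `z ∈ Ω`. -/
def LimQuotAtInfty (Ω : Set (Euc N)) (h : Euc N → ℝ → ℝ) (r L : ℝ) : Prop :=
  ∀ ε : ℝ, 0 < ε → ∃ M : ℝ, 0 < M ∧
    ∀ᵐ z ∂(vol Ω), ∀ x : ℝ, M ≤ |x| → |h z x / (|x| ^ (r - 2) * x) - L| ≤ ε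

/-- `lim_{x → 0} h(z,x) / (|x|^{r-2} x) = 0`, uniformly for almost all `z ∈ Ω`. -/
def LimQuotAtZero (Ω : Set (Euc N)) (h : Euc N → ℝ → ℝ) (r : ℝ) : Prop :=
  ∀ ε : ℝ, 0 < ε → ∃ δ : ℝ, 0 < δ ∧
    ∀ᵐ z ∂(vol Ω), ∀ x : ℝ, 0 < |x| → |x| ≤ δ → |h z x / (|x| ^ (r - 2) * x)| ≤ ε

/-- The primitive `∫₀ˣ h(z,s) ds`. -/
noncomputable def primitive (h : Euc N → ℝ → ℝ) (z : Euc N) (x : ℝ) : ℝ := ∫ s in (0 : ℝ)..x, h z s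

/-- Hypotheses on the parametric, `(p-1)`-sublinear nonlinearity `g`. -/
structure HypG (Ω : Set (Euc N)) (p q : ℝ) (g : Euc N → ℝ → ℝ) : Prop where
  caratheodory : IsCaratheodory Ω g
  zero : ∀ᵐ z ∂(vol Ω), g z 0 = 0
  locallyBounded : LocallyBounded Ω g
  sign : ∀ᵐ z ∂(vol Ω), ∀ x : ℝ, x ≠ 0 → 0 < g z x * x
  limZero : LimQuotAtZero Ω g p
  one_lt : 1 < q
  lt_p : q < p
  limInfty : LimQuotAtInfty Ω g q 0

/-- Hypotheses on the resonant nonlinearity `f`. -/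
structure HypF (Ω : Set (Euc N)) (p : ℝ) [Fact (1 < p)] (β : Euc N → ℝ) (q : ℝ)
    (f : Euc N → ℝ → ℝ) : Prop where
  caratheodory : IsCaratheodory Ω f
  zero : ∀ᵐ z ∂(vol Ω), f z 0 = 0
  locallyBounded : LocallyBounded Ω f
  /-- resonance with respect to a nonprincipal variational eigenvalue -/
  limInfty : ∃ m : ℕ, 2 ≤ m ∧ LimQuotAtInfty Ω f p (variationalEigenvalue Ω p β m)
  /-- `liminf_{x → ±∞} (p F(z,x) - f(z,x) x) / |x|^q > 0` uniformly for almost all `z` -/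
  liminfInfty : ∃ c : ℝ, 0 < c ∧ ∃ M : ℝ, 0 < M ∧ ∀ᵐ z ∂(vol Ω), ∀ x : ℝ, M ≤ |x| →
    c ≤ (p * primitive f z x - f z x * x) / |x| ^ q
  /-- `limsup_{x → 0} f(z,x) / (|x|^{p-2} x) ≤ ϑ(z)` uniformly for almost all `z` -/
  limsupZero : ∃ ϑ : Euc N → ℝ, MemLp ϑ ∞ (vol Ω) ∧
    (∀ᵐ z ∂(vol Ω), ϑ z ≤ variationalEigenvalue Ω p β 1) ∧
    (¬ ∀ᵐ z ∂(vol Ω), ϑ z = variationalEigenvalue Ω p β 1) ∧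
    ∀ ε : ℝ, 0 < ε → ∃ δ : ℝ, 0 < δ ∧ ∀ᵐ z ∂(vol Ω), ∀ x : ℝ, 0 < |x| → |x| ≤ δ →
      f z x / (|x| ^ (p - 2) * x) ≤ ϑ z + ε

/-- The energy functional `φ_λ(u) = τ(u)/p - λ ∫_Ω G(z,u) dz - ∫_Ω F(z,u) dz`. -/
noncomputable def energy (β : Euc N → ℝ) (g f : Euc N → ℝ → ℝ) (lam : ℝ) (u : W1p Ω p) : ℝ :=
  1 / p * tau β u - lam * (∫ z in Ω, primitive g z (fn u z)) - ∫ z in Ω, primitive f z (fn u z)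

end RobinResonant

/-! Write `k = λg + f`, with primitive `K`. The lower bound on `pF - fx` is of order `c|x|^q`, while
`g` contributes only `o(|x|^q)`. Since `q > 1`, what remains still dominates `|x|`, so `pK(z,x) -
k(z,x)x ≥ |x| - D`, together with the growth bound `|k(z,x)| ≤ A + C|x|^(p-1)`
(`exists_combined_bounds`). These two inequalities are all that the variational argument needs from
the nonlinearity (`ceramiCondition_of_bounds`).

Boundedness. In `pφ(u) - φ'(u)u` the term `τ(u)` cancels, so along a Cerami sequence `∫|uₙ|` is
bounded. Boundedness of `φ'(uₙ)uₙ` and the growth of `k` then give `‖Duₙ‖^p ≤ const + C‖uₙ‖ₚ^p`. If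
such functions had unbounded norms, their normalizations would, along a subsequence, converge in
`Lᵖ` by compact embedding; the limit is `0` because the `L¹` norms vanish, so the gradients vanish
too, against norm one (`exists_norm_le_of_grad_le`).

Convergence. Take a subsequence converging in `Lᵖ(Ω)` and test `φ'(uₙ) - φ'(uₘ)` with `uₙ - uₘ`. The
nonlinear term vanishes in the limit, the boundary term is nonnegative because `β ≥ 0` and `x ↦
|x|^(p-2)x` is monotone, and quantitative monotonicity makes the gradients Cauchy in `Lᵖ`.
Completeness of `W^{1,p}(Ω)` concludes. The trace enters only as a continuous linear map.

Two tools are built along the way. Rellich–Kondrachov (`totallyBounded_image_fn`) comes from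
comparing `u` with its means over balls shifted into `Ω` along an inward cone, so no extension
operator is needed. The `C¹` property comes from continuity of superposition operators `Lᵖ → L^{p'}`
(`IsNemytskii.continuous_map`) and the fact that a continuous Gateaux derivative is a Fréchet
derivative. -/

open MeasureTheory Filter Topology
open scoped ENNReal NNReal ContDiff

namespace RobinResonant

/-! ### Translation estimates for weakly differentiable functions -/

section Translation

variable {N : ℕ} {Ω : Set (Euc N)}

theorem measurable_segment {N : ℕ} (w : Euc N) :
    Measurable (fun z : ℝ × Euc N => z.2 + z.1 • w) := by fun_prop

theorem integrable_segment {F : Type*} [NormedAddCommGroup F] {v : Euc N → F}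
    (hvm : StronglyMeasurable v) (hv : Integrable v) (w : Euc N) :
    Integrable (fun z : ℝ × Euc N => v (z.2 + z.1 • w))
      ((volume.restrict (Set.Ioc (0 : ℝ) 1)).prod volume) := by
  have hm : StronglyMeasurable (fun z : ℝ × Euc N => v (z.2 + z.1 • w)) :=
    hvm.comp_measurable (measurable_segment w)
  rw [integrable_prod_iff hm.aestronglyMeasurable]
  refine ⟨Eventually.of_forall fun θ => hv.comp_add_right (θ • w), ?_⟩
  have : ∀ θ : ℝ, ∫ y, ‖v (y + θ • w)‖ = ∫ y, ‖v y‖ := fun θ =>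
    integral_add_right_eq_self (fun y => ‖v y‖) (θ • w)
  simp only [this]
  exact integrable_const _

/-- Along a segment that stays in `Ω`, the increment of a weakly differentiable function is the
integral of its directional derivative. -/
theorem IsWeakGradient.ae_sub_eq {u : Euc N → ℝ} {v : Euc N → Euc N}
    (huv : IsWeakGradient Ω u v)
    (hvm : StronglyMeasurable v)
    (hu : Integrable u) (hv : Integrable v)
    {V : Set (Euc N)} (hV : IsOpen V) {w : Euc N}
    (hVw : ∀ x ∈ V, ∀ θ ∈ Set.Icc (0 : ℝ) 1, x + θ • w ∈ Ω) :
    ∀ᵐ x, x ∈ V → u (x + w) - u x = ∫ θ in Set.Ioc (0 : ℝ) 1, inner ℝ (v (x + θ • w)) w := by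
  set D : Euc N → ℝ := fun x => ∫ θ in Set.Ioc (0 : ℝ) 1, inner ℝ (v (x + θ • w)) w with hD
  have hvw : Integrable (fun y => inner ℝ (v y) w) := hv.inner_const w
  have hvwm : StronglyMeasurable (fun y => inner ℝ (v y) w) := hvm.inner stronglyMeasurable_const
  have hprod := integrable_segment hvwm hvw w
  have hDint : Integrable D := hprod.integral_prod_right
  have hushift : Integrable (fun x => u (x + w)) := hu.comp_add_right w
  -- Fundamental lemma of the calculus of variations: it suffices that the difference of the two
  -- sides integrates to zero against every test function supported in `V`.
  have key := hV.ae_eq_zero_of_integral_contDiff_smul_eq_zero (μ := volume)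
    (f := fun x => u (x + w) - u x - D x)
    (LocallyIntegrable.locallyIntegrableOn
      (show Integrable (fun x => u (x + w) - u x - D x) from
        (hushift.sub hu).sub hDint).locallyIntegrable V) ?_
  · filter_upwards [key] with x hx hxV
    linarith [hx hxV]
  intro φ hφ hc hs
  obtain ⟨C, hC⟩ := hc.exists_bound_of_continuous hφ.continuous
  have hmulφ : ∀ f : Euc N → ℝ, Integrable f → ∀ θ : ℝ,
      Integrable (fun y => f y * φ (y - θ • w)) := by
    intro f hf θ
    refine hf.mul_bdd (c := C) ?_ (Eventually.of_forall fun y => hC _)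
    exact (hφ.continuous.comp (by fun_prop)).aestronglyMeasurable
  have hdφ : Continuous (fun y => fderiv ℝ φ y w) :=
    (hφ.continuous_fderiv (by simp)).clm_apply continuous_const
  obtain ⟨C', hC'⟩ := (hc.fderiv_apply (𝕜 := ℝ) w).exists_bound_of_continuous hdφ
  -- the weak formulation, tested with the translates of `φ`
  have h1 : ∀ θ ∈ Set.Ioc (0 : ℝ) 1, ∫ y, u y * fderiv ℝ φ (y - θ • w) w
      = - ∫ x, φ x * inner ℝ (v (x + θ • w)) w := by
    intro θ hθ
    set ψ : Euc N → ℝ := fun y => φ (y - θ • w) with hψ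
    have hψd : ContDiff ℝ ∞ ψ := hφ.comp (by fun_prop)
    have hψc : HasCompactSupport ψ :=
      hc.comp_homeomorph (Homeomorph.subRight (θ • w))
    have hts : tsupport ψ ⊆ Ω := by
      intro y hy
      have : tsupport ψ = (Homeomorph.subRight (θ • w)) ⁻¹' tsupport φ :=
        tsupport_comp_eq_preimage φ (Homeomorph.subRight (θ • w))
      rw [this] at hy
      have h := hVw _ (hs hy) θ ⟨hθ.1.le, hθ.2⟩
      simpa using h
    have hfd : ∀ y, fderiv ℝ ψ y = fderiv ℝ φ (y - θ • w) := fun y => by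
      rw [hψ, fderiv_comp_sub]
    have := huv ψ hψd hψc hts w
    rw [setIntegral_eq_integral_of_forall_compl_eq_zero,
      setIntegral_eq_integral_of_forall_compl_eq_zero] at this
    · simp only [hfd] at this
      rw [this, ← integral_add_right_eq_self _ (θ • w)]
      simp [hψ, mul_comm]
    · intro x hx
      rw [image_eq_zero_of_notMem_tsupport fun h => hx (hts h), mul_zero]
    · intro x hx
      rw [image_eq_zero_of_notMem_tsupport fun h => hx (hts (tsupport_fderiv_subset ℝ h))]
      simp
  -- integrate in `θ`
  have hL : Integrable (fun z : ℝ × Euc N => u z.2 * fderiv ℝ φ (z.2 - z.1 • w) w)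
      ((volume.restrict (Set.Ioc (0 : ℝ) 1)).prod volume) := by
    refine Integrable.mul_bdd (c := C') (hu.comp_snd _) ?_ (Eventually.of_forall fun z => hC' _)
    exact (hdφ.comp (by fun_prop : Continuous fun z : ℝ × Euc N => z.2 - z.1 • w)).aestronglyMeasurable
  have hR : Integrable (fun z : ℝ × Euc N => φ z.2 * inner ℝ (v (z.2 + z.1 • w)) w)
      ((volume.restrict (Set.Ioc (0 : ℝ) 1)).prod volume) :=
    Integrable.bdd_mul (c := C) hprod (hφ.continuous.comp continuous_snd).aestronglyMeasurable
      (Eventually.of_forall fun z => hC _)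
  have h2 : ∫ θ in Set.Ioc (0 : ℝ) 1, ∫ y, u y * fderiv ℝ φ (y - θ • w) w
      = - ∫ x, φ x * D x := by
    rw [setIntegral_congr_fun measurableSet_Ioc h1, integral_neg,
      integral_integral_swap (f := fun θ x => φ x * inner ℝ (v (x + θ • w)) w) hR]
    simp only [hD, integral_const_mul]
  -- The fundamental theorem of calculus is applied to the smooth `φ`, not to `u`: the integrand is
  -- the `θ`-derivative of `-φ(y - θw)`.
  have h3 : ∀ y, ∫ θ in Set.Ioc (0 : ℝ) 1, u y * fderiv ℝ φ (y - θ • w) w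
      = u y * φ y - u y * φ (y - w) := by
    intro y
    have hderiv : ∀ θ ∈ Set.uIcc (0 : ℝ) 1, HasDerivAt (fun θ : ℝ => - φ (y - θ • w))
        (fderiv ℝ φ (y - θ • w) w) θ := by
      intro θ _
      have h := (((hasDerivAt_id θ).smul_const w).const_sub y)
      have h' := ((hφ.differentiable (by simp) (y - θ • w)).hasFDerivAt.comp_hasDerivAt θ h).neg
      simpa [Function.comp_def] using! h'
    have := intervalIntegral.integral_eq_sub_of_hasDerivAt hderiv
      ((hdφ.comp (by fun_prop : Continuous fun θ : ℝ => y - θ • w)).intervalIntegrable _ _)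
    rw [integral_const_mul, ← intervalIntegral.integral_of_le zero_le_one, this]
    simp
    ring
  rw [integral_integral_swap (f := fun θ y => u y * fderiv ℝ φ (y - θ • w) w) hL] at h2
  simp only [h3] at h2
  have i0 : Integrable (fun y => u y * φ y) := by simpa using hmulφ u hu 0
  have i1 : Integrable (fun y => u y * φ (y - w)) := by simpa using hmulφ u hu 1
  rw [integral_sub i0 i1, ← integral_add_right_eq_self (fun y => u y * φ (y - w)) w] at h2
  simp only [add_sub_cancel_right] at h2
  have i2 : Integrable (fun y => u (y + w) * φ y) := by
    simpa using hmulφ _ hushift 0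
  have i3 : Integrable (fun y => φ y * D y) := by
    simpa [mul_comm] using hmulφ _ hDint 0
  have : (fun x => φ x • (u (x + w) - u x - D x))
      = fun x => u (x + w) * φ x - u x * φ x - φ x * D x := by
    ext x; simp only [smul_eq_mul]; ring
  have h4 : ∫ x, (u (x + w) * φ x - u x * φ x - φ x * D x)
      = (∫ x, (u (x + w) * φ x - u x * φ x)) - ∫ x, φ x * D x := integral_sub (i2.sub i0) i3
  rw [this, h4, integral_sub i2 i0]
  linarith

/-- Jensen's inequality for `t ↦ t^p`, obtained from Hölder against the constant `1`. -/
theorem rpow_lintegral_le {α : Type*} [MeasurableSpace α] {μ : Measure α} [IsProbabilityMeasure μ]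
    {p : ℝ} (hp : 1 < p) {f : α → ℝ≥0∞} (hf : AEMeasurable f μ) :
    (∫⁻ a, f a ∂μ) ^ p ≤ ∫⁻ a, f a ^ p ∂μ := by
  have h := ENNReal.lintegral_mul_le_Lp_mul_Lq μ (Real.HolderConjugate.conjExponent hp) hf
    (aemeasurable_const (b := (1 : ℝ≥0∞)))
  simp only [Pi.mul_apply, mul_one, ENNReal.one_rpow, lintegral_const, measure_univ] at h
  calc _ ≤ ((∫⁻ a, f a ^ p ∂μ) ^ (1 / p)) ^ p := ENNReal.rpow_le_rpow h (by linarith)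
    _ = _ := by rw [← ENNReal.rpow_mul, one_div_mul_cancel (by linarith), ENNReal.rpow_one]

/-- The increment is an average of `⟨v(x + θw), w⟩` over `θ`; Jensen moves the power inside, and
after Fubini each translate contributes the same integral of `‖v‖^p`. -/
theorem IsWeakGradient.lintegral_translate_le {u : Euc N → ℝ} {v : Euc N → Euc N}
    (huv : IsWeakGradient Ω u v)
    (hvm : StronglyMeasurable v)
    (hu : Integrable u) (hv : Integrable v) {p : ℝ} (hp : 1 < p)
    {V : Set (Euc N)} (hV : IsOpen V) {w : Euc N}
    (hVw : ∀ x ∈ V, ∀ θ ∈ Set.Icc (0 : ℝ) 1, x + θ • w ∈ Ω) :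
    ∫⁻ x in V, ‖u (x + w) - u x‖ₑ ^ p ≤ ‖w‖ₑ ^ p * ∫⁻ x, ‖v x‖ₑ ^ p := by
  have hp0 : 0 ≤ p := by linarith
  have : IsProbabilityMeasure (volume.restrict (Set.Ioc (0 : ℝ) 1)) := ⟨by simp⟩
  have hvj : Measurable (fun z : Euc N × ℝ => ‖v (z.1 + z.2 • w)‖ₑ) :=
    hvm.enorm.comp (by fun_prop)
  have hpt : ∀ᵐ x ∂(volume.restrict V), ‖u (x + w) - u x‖ₑ ^ p
      ≤ ‖w‖ₑ ^ p * ∫⁻ θ in Set.Ioc (0 : ℝ) 1, ‖v (x + θ • w)‖ₑ ^ p := by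
    rw [ae_restrict_iff' hV.measurableSet]
    filter_upwards [huv.ae_sub_eq hvm hu hv hV hVw] with x hx hxV
    have hm : Measurable (fun θ : ℝ => ‖v (x + θ • w)‖ₑ) := hvm.enorm.comp (by fun_prop)
    have h1 : ‖u (x + w) - u x‖ₑ ≤ ‖w‖ₑ * ∫⁻ θ in Set.Ioc (0 : ℝ) 1, ‖v (x + θ • w)‖ₑ := by
      rw [hx hxV, ← lintegral_const_mul _ hm]
      refine (enorm_integral_le_lintegral_enorm _).trans (lintegral_mono fun θ => ?_)
      rw [← ofReal_norm, ← ofReal_norm, ← ofReal_norm,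
        ← ENNReal.ofReal_mul (norm_nonneg _)]
      exact ENNReal.ofReal_le_ofReal ((norm_inner_le_norm _ _).trans (mul_comm _ _).le)
    calc _ ≤ (‖w‖ₑ * ∫⁻ θ in Set.Ioc (0 : ℝ) 1, ‖v (x + θ • w)‖ₑ) ^ p :=
          ENNReal.rpow_le_rpow h1 hp0
      _ ≤ _ := by
          rw [ENNReal.mul_rpow_of_nonneg _ _ hp0]
          gcongr
          exact rpow_lintegral_le hp hm.aemeasurable
  calc _ ≤ ∫⁻ x in V, ‖w‖ₑ ^ p * ∫⁻ θ in Set.Ioc (0 : ℝ) 1, ‖v (x + θ • w)‖ₑ ^ p :=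
        lintegral_mono_ae hpt
    _ ≤ ∫⁻ x, ‖w‖ₑ ^ p * ∫⁻ θ in Set.Ioc (0 : ℝ) 1, ‖v (x + θ • w)‖ₑ ^ p :=
        setLIntegral_le_lintegral _ _
    _ = ‖w‖ₑ ^ p * ∫⁻ θ in Set.Ioc (0 : ℝ) 1, ∫⁻ x, ‖v (x + θ • w)‖ₑ ^ p := by
        rw [lintegral_const_mul _ (Measurable.lintegral_prod_right (hvj.pow_const p)),
          lintegral_lintegral_swap (hvj.pow_const p).aemeasurable]
    _ = _ := by
        congr 1
        have : ∀ θ : ℝ, ∫⁻ x, ‖v (x + θ • w)‖ₑ ^ p = ∫⁻ x, ‖v x‖ₑ ^ p := fun θ =>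
          lintegral_add_right_eq_self (fun x => ‖v x‖ₑ ^ p) (θ • w)
        simp [this]

end Translation

/-! ### Inward cones at points of the closure -/

section Geometry

variable {N : ℕ} {Ω : Set (Euc N)}

/-- Near every point of its closure, `Ω` can be translated into itself along a ball of
directions. -/
def HasInwardCone (Ω : Set (Euc N)) (x₀ : Euc N) : Prop :=
  ∃ ν : Euc N, ‖ν‖ ≤ 1 ∧ ∃ r > 0, ∃ κ > 0, κ ≤ 1 ∧ ∃ s₀ > 0, ∀ s : ℝ, 0 < s → s ≤ s₀ → ∀ w : Euc N,
    ‖w - s • ν‖ ≤ κ * s → ∀ x ∈ Ω ∩ Metric.ball x₀ r, ∀ θ ∈ Set.Icc (0 : ℝ) 1, x + θ • w ∈ Ω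

theorem norm_le_of_mem_cone {N : ℕ} {ν w : Euc N} {κ s : ℝ} (hν : ‖ν‖ ≤ 1) (hκ : κ ≤ 1)
    (hs : 0 < s) (hw : ‖w - s • ν‖ ≤ κ * s) : ‖w‖ ≤ 2 * s := by
  have h1 : ‖w‖ ≤ ‖w - s • ν‖ + ‖s • ν‖ := by
    simpa using norm_add_le (w - s • ν) (s • ν)
  rw [norm_smul, Real.norm_of_nonneg hs.le] at h1
  nlinarith

/-- At an interior point every short direction is admissible, so the axis is `0` and the opening is
`κ = 1`. -/
theorem hasInwardCone_of_mem (hΩ : IsOpen Ω) {x₀ : Euc N} (hx₀ : x₀ ∈ Ω) :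
    HasInwardCone Ω x₀ := by
  obtain ⟨R, hR, hball⟩ := Metric.isOpen_iff.1 hΩ x₀ hx₀
  refine ⟨0, by simp, R / 2, by positivity, 1, one_pos, le_rfl, R / 2, by positivity, ?_⟩
  intro s hs hs' w hw x hx θ hθ
  apply hball
  have h1 := hx.2
  rw [Metric.mem_ball, dist_eq_norm] at h1 ⊢
  have h2 : x + θ • w - x₀ = (x - x₀) + θ • w := by abel
  have h3 : ‖θ • w‖ ≤ R / 2 := by
    rw [norm_smul, Real.norm_of_nonneg hθ.1]
    simp only [smul_zero, sub_zero, one_mul] at hw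
    nlinarith [hθ.2, norm_nonneg w, hθ.1]
  rw [h2]
  linarith [norm_add_le (x - x₀) (θ • w)]

/-- The height `Γ` above the graph grows at unit rate along `ν` and is locally `K`-Lipschitz. Moving
by `θw` with `‖w - sν‖ ≤ s/(K+1)` gains `θs` and loses at most `Kθs/(K+1) ≤ θs`, so `Γ` stays
positive. -/
theorem HasC2Boundary.hasInwardCone (hbdry : HasC2Boundary Ω) {x₀ : Euc N}
    (hx₀ : x₀ ∈ frontier Ω) : HasInwardCone Ω x₀ := by
  obtain ⟨ν, hν, γ, hγ, U, hU, hΩ⟩ := hbdry x₀ hx₀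
  set Γ : Euc N → ℝ := fun x => inner ℝ ν x - γ (x - (inner ℝ ν x) • ν) with hΓ
  have hΓd : ContDiff ℝ 1 Γ := by
    have : ContDiff ℝ 1 γ := hγ.of_le (by norm_num)
    have h1 : ContDiff ℝ 1 (fun x : Euc N => inner ℝ ν x) := contDiff_const.inner ℝ contDiff_id
    exact h1.sub (this.comp (contDiff_id.sub (h1.smul contDiff_const)))
  have hΓν : ∀ (x : Euc N) (t : ℝ), Γ (x + t • ν) = Γ x + t := by
    intro x t
    simp only [hΓ, inner_add_right, real_inner_smul_right, real_inner_self_eq_norm_sq, hν]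
    have : x + t • ν - (inner ℝ ν x + t * 1 ^ 2) • ν = x - (inner ℝ ν x) • ν := by
      rw [one_pow, mul_one, add_smul]; abel
    rw [this]; ring
  obtain ⟨K, T, hT, hLip⟩ := (hΓd.contDiffAt (x := x₀)).exists_lipschitzOnWith
  obtain ⟨R, hR, hball⟩ := Metric.mem_nhds_iff.1 (inter_mem hU hT)
  -- Displacements have length at most `2s ≤ R/4`, so points starting within `R/2` of `x₀` stay in
  -- the ball of radius `R` where the graph description and the Lipschitz bound hold.
  refine ⟨ν, hν.le, R / 2, by positivity, 1 / (K + 1), by positivity, ?_, R / 8, by positivity, ?_⟩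
  · rw [div_le_one (by positivity)]; linarith [K.2]
  intro s hs hs' w hw x hx θ hθ
  have hκ1 : 1 / ((K : ℝ) + 1) ≤ 1 := by
    rw [div_le_one (by positivity)]; linarith [K.2]
  have hwn := norm_le_of_mem_cone hν.le hκ1 hs hw
  have h1 := hx.2
  rw [Metric.mem_ball, dist_eq_norm] at h1
  have mem : ∀ y : Euc N, ‖y‖ ≤ 2 * s → x + y ∈ U ∩ T := by
    intro y hy
    apply hball
    rw [Metric.mem_ball, dist_eq_norm]
    have h2 : x + y - x₀ = (x - x₀) + y := by abel
    rw [h2]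
    linarith [norm_add_le (x - x₀) y]
  have hθw : ‖θ • w‖ ≤ 2 * s := by
    rw [norm_smul, Real.norm_of_nonneg hθ.1]
    nlinarith [hθ.2, norm_nonneg w, hθ.1]
  have hθν : ‖(θ * s) • ν‖ ≤ 2 * s := by
    rw [norm_smul, hν, Real.norm_of_nonneg (mul_nonneg hθ.1 hs.le)]
    nlinarith [hθ.2, hθ.1]
  have hxU : x ∈ U := by simpa using (mem 0 (by simp; positivity)).1
  have hxΓ : 0 < Γ x := by
    have := (hΩ x hxU).1 hx.1
    simp only [hΓ]; linarith
  refine (hΩ _ (mem _ hθw).1).2 ?_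
  suffices 0 < Γ (x + θ • w) by simp only [hΓ] at this; linarith
  have hd := hLip.dist_le_mul _ (mem _ hθw).2 _ (mem _ hθν).2
  rw [hΓν, Real.dist_eq, dist_eq_norm] at hd
  have h3 : x + θ • w - (x + (θ * s) • ν) = θ • (w - s • ν) := by
    rw [smul_sub, smul_smul]; abel
  rw [h3, norm_smul, Real.norm_of_nonneg hθ.1] at hd
  have h4 : (K : ℝ) * (θ * ‖w - s • ν‖) ≤ θ * s := by
    have : (K : ℝ) * (1 / (K + 1) * s) ≤ s := by
      have : (K : ℝ) * (1 / (K + 1) * s) = K / (K + 1) * s := by ring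
      rw [this]
      have : (K : ℝ) / (K + 1) ≤ 1 := by rw [div_le_one (by positivity)]; linarith
      nlinarith
    calc (K : ℝ) * (θ * ‖w - s • ν‖) ≤ K * (θ * (1 / (K + 1) * s)) := by
          gcongr; exact hθ.1
      _ = θ * (K * (1 / (K + 1) * s)) := by ring
      _ ≤ θ * s := mul_le_mul_of_nonneg_left this hθ.1
  have := abs_le.1 (hd.trans h4)
  linarith [this.1]

theorem hasInwardCone_of_mem_closure (hΩ : IsOpen Ω) (hbdry : HasC2Boundary Ω) {x₀ : Euc N}
    (hx₀ : x₀ ∈ closure Ω) : HasInwardCone Ω x₀ := by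
  by_cases h : x₀ ∈ Ω
  · exact hasInwardCone_of_mem hΩ h
  · exact hbdry.hasInwardCone ⟨hx₀, by rwa [hΩ.interior_eq]⟩

end Geometry

/-! ### Extension by zero and mean-value functionals -/

section Extension

variable {N : ℕ} {Ω : Set (Euc N)} {p : ℝ} [hp : Fact (1 < p)]

/-- `u ↦ u` as a continuous linear map into `Lᵖ(Ω)`. -/
noncomputable def fnL : W1p Ω p →L[ℝ] Lp ℝ (ENNReal.ofReal p) (vol Ω) :=
  (WithLp.fstL _ ℝ _ _).comp (W1p Ω p).subtypeL

/-- `u ↦ Du` as a continuous linear map into `Lᵖ(Ω; ℝᴺ)`. -/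
noncomputable def gradL : W1p Ω p →L[ℝ] Lp (Euc N) (ENNReal.ofReal p) (vol Ω) :=
  (WithLp.sndL _ ℝ _ _).comp (W1p Ω p).subtypeL

@[simp] theorem fnL_apply (u : W1p Ω p) : fnL u = fn u := rfl
@[simp] theorem gradL_apply (u : W1p Ω p) : gradL u = grad u := rfl

theorem toReal_ofReal_exponent : (ENNReal.ofReal p).toReal = p :=
  ENNReal.toReal_ofReal (by linarith [hp.out])

theorem norm_rpow_eq (u : W1p Ω p) : ‖u‖ ^ p = ‖fn u‖ ^ p + ‖grad u‖ ^ p := by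
  have hp0 : 0 < p := by linarith [hp.out]
  have h : ‖u.1‖ = (‖fn u‖ ^ p + ‖grad u‖ ^ p) ^ (1 / p) := by
    rw [WithLp.prod_norm_eq_add (by rw [toReal_ofReal_exponent]; exact hp0)]
    simp only [toReal_ofReal_exponent]
    rfl
  rw [Submodule.coe_norm] at *
  rw [h, ← Real.rpow_mul (by positivity), one_div_mul_cancel hp0.ne', Real.rpow_one]

theorem norm_grad_le (u : W1p Ω p) : ‖grad u‖ ≤ ‖u‖ := by
  have hp0 : 0 < p := by linarith [hp.out]
  rw [← Real.rpow_le_rpow_iff (norm_nonneg _) (norm_nonneg _) hp0, norm_rpow_eq]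
  linarith [Real.rpow_nonneg (norm_nonneg (fn u)) p]

theorem lintegral_enorm_rpow {α F : Type*} [MeasurableSpace α] {μ : Measure α}
    [NormedAddCommGroup F] (f : Lp F (ENNReal.ofReal p) μ) :
    ∫⁻ x, ‖f x‖ₑ ^ p ∂μ = ‖f‖ₑ ^ p := by
  have hp0 : 0 < p := by linarith [hp.out]
  rw [Lp.enorm_def, eLpNorm_eq_lintegral_rpow_enorm_toReal (by simpa using hp0) (by simp),
    toReal_ofReal_exponent, ← ENNReal.rpow_mul, one_div_mul_cancel hp0.ne', ENNReal.rpow_one]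

/-- Extension by zero of an element of `W^{1,p}(Ω)`. -/
noncomputable def ext (u : W1p Ω p) : Euc N → ℝ := Ω.indicator (fn u)

/-- Extension by zero of the gradient of an element of `W^{1,p}(Ω)`. -/
noncomputable def extGrad (u : W1p Ω p) : Euc N → Euc N := Ω.indicator (grad u)

theorem lintegral_indicator_enorm_rpow {F : Type*} [NormedAddCommGroup F] (hΩ : MeasurableSet Ω)
    (f : Lp F (ENNReal.ofReal p) (vol Ω)) :
    ∫⁻ x, ‖Ω.indicator f x‖ₑ ^ p = ‖f‖ₑ ^ p := by
  have hp0 : 0 < p := by linarith [hp.out]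
  rw [← lintegral_enorm_rpow, ← lintegral_indicator hΩ]
  congr 1 with x
  by_cases h : x ∈ Ω
  · simp [h]
  · simp [h, hp0]

theorem integrable_indicator_Lp {F : Type*} [NormedAddCommGroup F] (hΩ : MeasurableSet Ω)
    (hfin : volume Ω ≠ ⊤) (f : Lp F (ENNReal.ofReal p) (vol Ω)) :
    Integrable (Ω.indicator f) := by
  have : IsFiniteMeasure (vol Ω) := ⟨by simpa using hfin.lt_top⟩
  rw [integrable_indicator_iff hΩ]
  exact (Lp.memLp f).integrable factOneLe.out

/-- Test functions are supported in `Ω`, so nothing is asserted across `∂Ω`; extending by zero only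
supplies globally defined integrable functions for the translation estimates. -/
theorem isWeakGradient_ext (hΩ : MeasurableSet Ω) (u : W1p Ω p) :
    IsWeakGradient Ω (ext u) (extGrad u) := by
  intro φ hφ hc hs e
  have h := u.2 φ hφ hc hs e
  have h1 : ∫ z in Ω, ext u z * fderiv ℝ φ z e = ∫ z in Ω, u.1.fst z * fderiv ℝ φ z e :=
    setIntegral_congr_fun hΩ fun z hz => by simp [ext, hz, fn]
  have h2 : ∫ z in Ω, inner ℝ (extGrad u z) e * φ z = ∫ z in Ω, inner ℝ (u.1.snd z) e * φ z :=
    setIntegral_congr_fun hΩ fun z hz => by simp [extGrad, hz, grad]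
  rw [h1, h2, h]

/-- Continuity is Hölder's inequality: the functional is the pairing with the indicator of `B`,
which lies in the conjugate space because `Ω` has finite measure. -/
theorem exists_setIntegral_clm (hΩ : MeasurableSet Ω) (hfin : volume Ω ≠ ⊤) {B : Set (Euc N)}
    (hB : MeasurableSet B) :
    ∃ ℓ : W1p Ω p →L[ℝ] ℝ, ∀ u, ℓ u = ∫ x in B, ext u x := by
  have h1 : (ENNReal.conjExponent (ENNReal.ofReal p)).HolderConjugate (ENNReal.ofReal p) :=
    (ENNReal.HolderConjugate.conjExponent (factOneLe (p := p)).out).symm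
  have : Fact (1 ≤ ENNReal.conjExponent (ENNReal.ofReal p)) :=
    ⟨ENNReal.HolderConjugate.one_le _ (ENNReal.ofReal p)⟩
  have hBfin : vol Ω B ≠ ⊤ := by
    refine ((measure_mono (Set.subset_univ B)).trans_lt ?_).ne
    simpa using hfin.lt_top
  refine ⟨((ContinuousLinearMap.mul ℝ ℝ).lpPairing (vol Ω)
    (ENNReal.conjExponent (ENNReal.ofReal p)) (ENNReal.ofReal p)
    (indicatorConstLp _ hB hBfin 1)).comp fnL, fun u => ?_⟩
  have h2 : ∫ x in B, ext u x = ∫ x in Ω, B.indicator (ext u) x := by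
    rw [← integral_indicator hB, setIntegral_eq_integral_of_forall_compl_eq_zero]
    intro x hx
    by_cases h : x ∈ B <;> simp [h, ext, hx]
  rw [h2, ContinuousLinearMap.comp_apply, ContinuousLinearMap.lpPairing_eq_integral]
  apply integral_congr_ae
  filter_upwards [indicatorConstLp_coeFn (p := ENNReal.conjExponent (ENNReal.ofReal p))
    (hs := hB) (hμs := hBfin) (c := (1 : ℝ)), ae_restrict_mem hΩ] with x hx hxΩ
  rw [hx]
  by_cases h : x ∈ B <;> simp [h, ext, hxΩ]

end Extension

/-! ### Compact embedding of `W^{1,p}(Ω)` in `Lᵖ(Ω)` -/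

section LocalApproximation

variable {N : ℕ} {Ω : Set (Euc N)} {p : ℝ} [hp : Fact (1 < p)]

/-- The difference between a function and its mean over a ball is controlled by translates. -/
theorem enorm_sub_average_rpow_le {u : Euc N → ℝ} (hum : StronglyMeasurable u) (hu : Integrable u)
    {p : ℝ} (hp : 1 < p) {x c b : Euc N} {δ : ℝ} (hδ : 0 < δ) (hx : dist x c ≤ δ) :
    ‖u x - ⨍ y in Metric.closedBall (c + b) δ, u y‖ₑ ^ p ≤
      (volume (Metric.closedBall (0 : Euc N) δ))⁻¹ *
        ∫⁻ w in Metric.closedBall b (2 * δ), ‖u (x + w) - u x‖ₑ ^ p := by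
  set B := Metric.closedBall (c + b) δ with hB
  have hvol : volume B = volume (Metric.closedBall (0 : Euc N) δ) := by
    rw [hB, Measure.addHaar_closedBall _ _ hδ.le, Measure.addHaar_closedBall _ _ hδ.le]
  have hB0 : volume B ≠ 0 := (Metric.measure_closedBall_pos _ _ hδ).ne'
  have hBt : volume B ≠ ⊤ := measure_closedBall_lt_top.ne
  set μ : Measure (Euc N) := (volume B)⁻¹ • volume.restrict B with hμ
  have hprob : IsProbabilityMeasure μ := ⟨by
    simp [hμ, ENNReal.inv_mul_cancel hB0 hBt]⟩
  have hum' : Integrable u μ := hu.integrableOn.smul_measure (by simp [hB0])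
  have havg : ⨍ y in B, u y = ∫ y, u y ∂μ := by
    simp [average, hμ]
  have h1 : u x - ⨍ y in B, u y = ∫ y, (u x - u y) ∂μ := by
    rw [havg, integral_sub (integrable_const _) hum']; simp
  have hm : Measurable fun y => ‖u x - u y‖ₑ := (hum.measurable.const_sub (u x)).enorm
  calc ‖u x - ⨍ y in B, u y‖ₑ ^ p ≤ (∫⁻ y, ‖u x - u y‖ₑ ∂μ) ^ p := by
        rw [h1]
        exact ENNReal.rpow_le_rpow (enorm_integral_le_lintegral_enorm _) (by linarith)
    _ ≤ ∫⁻ y, ‖u x - u y‖ₑ ^ p ∂μ := rpow_lintegral_le hp hm.aemeasurable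
    _ = (volume B)⁻¹ * ∫⁻ y in B, ‖u x - u y‖ₑ ^ p := by
        rw [hμ, lintegral_smul_measure, smul_eq_mul]
    _ ≤ _ := by
        rw [hvol]
        refine mul_le_mul_right ?_ _
        rw [← lintegral_indicator Metric.isClosed_closedBall.measurableSet,
          ← lintegral_indicator Metric.isClosed_closedBall.measurableSet,
          ← lintegral_add_left_eq_self _ x]
        refine lintegral_mono fun w => ?_
        by_cases hw : x + w ∈ B
        · have : w ∈ Metric.closedBall b (2 * δ) := by
            rw [hB, mem_closedBall_iff_norm] at hw
            rw [dist_eq_norm] at hx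
            rw [mem_closedBall_iff_norm]
            have h2 : w - b = (x + w - (c + b)) - (x - c) := by abel
            rw [h2]
            linarith [norm_sub_le (x + w - (c + b)) (x - c)]
          rw [Set.indicator_of_mem this, Set.indicator_of_mem hw, ← enorm_neg, neg_sub]
        · rw [Set.indicator_of_notMem hw]; exact zero_le

set_option maxHeartbeats 1000000 in
-- Near `x₀`, `u` is compared with finitely many means over balls of radius `δ` displaced by `sν`
-- into the cone. The error is an average of translation increments of length at most `2s`, hence of
-- size `s^p‖Du‖^p`, and `s` is free.
theorem exists_local_approximation (hΩ : IsOpen Ω) (hbdd : Bornology.IsBounded Ω) {x₀ : Euc N}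
    (hcone : HasInwardCone Ω x₀) :
    ∃ r > 0, ∀ ε : ℝ, 0 < ε → ∃ (t : Finset (W1p Ω p →L[ℝ] ℝ)) (K : ℝ≥0∞), K ≠ ⊤ ∧ ∀ u,
      ∫⁻ x in Ω ∩ Metric.ball x₀ r, ‖ext u x‖ₑ ^ p
        ≤ ENNReal.ofReal ε * ‖u‖ₑ ^ p + K * ∑ ℓ ∈ t, ‖ℓ u‖ₑ ^ p := by
  classical
  have hp1 := hp.out
  have hp0 : 0 < p := by linarith
  have hmeas := hΩ.measurableSet
  have hfin : volume Ω ≠ ⊤ := hbdd.measure_lt_top.ne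
  obtain ⟨ν, hν, r, hr, κ, hκ, hκ1, s₀, hs₀, H⟩ := hcone
  refine ⟨r, hr, fun ε hε => ?_⟩
  set V := Ω ∩ Metric.ball x₀ r with hV
  have hVo : IsOpen V := hΩ.inter Metric.isOpen_ball
  have hVfin : volume V ≠ ⊤ := ((measure_mono Set.inter_subset_left).trans_lt hfin.lt_top).ne
  -- choice of the translation length
  obtain ⟨s, hs, hss₀, hsε⟩ : ∃ s > 0, s ≤ s₀ ∧ 2 ^ (p - 1) * 2 ^ N * (2 * s) ^ p ≤ ε := by
    have hcont : Tendsto (fun s : ℝ => 2 ^ (p - 1) * 2 ^ N * (2 * s) ^ p) (𝓝[>] 0) (𝓝 0) := by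
      have : ContinuousAt (fun s : ℝ => (2 : ℝ) ^ (p - 1) * 2 ^ N * (2 * s) ^ p) 0 :=
        continuousAt_const.mul ((continuousAt_const.mul continuousAt_id).rpow_const (Or.inr hp0.le))
      have h2 := this.tendsto
      simp only [mul_zero, Real.zero_rpow hp0.ne'] at h2
      exact h2.mono_left nhdsWithin_le_nhds
    obtain ⟨s, h1, h2, h3⟩ := ((hcont.eventually (ge_mem_nhds hε)).and
      ((Ioc_mem_nhdsGT hs₀))).exists
    exact ⟨s, h2, h3, h1⟩
  -- The ball of centre `sν` and radius `2δ = κs` is exactly the set of admissible displacements.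
  -- Since `κ` cancels in the ratio of volumes of balls of radii `2δ` and `δ`, the error constant
  -- `2^N` does not depend on `s`.
  set δ : ℝ := κ * s / 2 with hδdef
  have hδ : 0 < δ := by positivity
  have h2δ : 2 * δ = κ * s := by rw [hδdef]; ring
  obtain ⟨C, hCfin, hC⟩ : ∃ C : Set (Euc N), C.Finite ∧ V ⊆ ⋃ y ∈ C, Metric.ball y δ := by
    have : TotallyBounded V :=
      (hbdd.subset Set.inter_subset_left).isCompact_closure.totallyBounded.subset subset_closure
    exact Metric.totallyBounded_iff.1 this δ hδ
  have hclm : ∀ c : Euc N, ∃ ℓ : W1p Ω p →L[ℝ] ℝ, ∀ u,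
      ℓ u = ⨍ y in Metric.closedBall (c + s • ν) δ, ext u y := by
    intro c
    obtain ⟨ℓ, hℓ⟩ := exists_setIntegral_clm (p := p) hmeas hfin
      (Metric.isClosed_closedBall (x := c + s • ν) (ε := δ)).measurableSet
    refine ⟨(volume.real (Metric.closedBall (c + s • ν) δ))⁻¹ • ℓ, fun u => ?_⟩
    rw [setAverage_eq, smul_apply, hℓ]
  choose ℓ hℓ using hclm
  set M := volume (Metric.closedBall (0 : Euc N) δ) with hM
  have hM0 : M ≠ 0 := (Metric.measure_closedBall_pos _ _ hδ).ne'
  have hMt : M ≠ ⊤ := measure_closedBall_lt_top.ne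
  have hC2 : (2 : ℝ≥0∞) ^ (p - 1) ≠ ⊤ := ENNReal.rpow_ne_top_of_nonneg (by linarith) (by simp)
  refine ⟨hCfin.toFinset.image ℓ, 2 ^ (p - 1) * volume V, ENNReal.mul_ne_top hC2 hVfin, fun u => ?_⟩
  set U := ext u with hU
  have hUm : StronglyMeasurable U := (Lp.stronglyMeasurable _).indicator hmeas
  have hGm : StronglyMeasurable (extGrad u) := (Lp.stronglyMeasurable _).indicator hmeas
  have hUi : Integrable U := integrable_indicator_Lp hmeas hfin _
  have hGi : Integrable (extGrad u) := integrable_indicator_Lp hmeas hfin _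
  set S := ∑ ℓ' ∈ hCfin.toFinset.image ℓ, ‖ℓ' u‖ₑ ^ p with hS
  set B := Metric.closedBall (s • ν) (2 * δ) with hBdef
  have hpair : Measurable (fun z : Euc N × Euc N => ‖U (z.1 + z.2) - U z.1‖ₑ ^ p) :=
    (((hUm.measurable.comp (measurable_fst.add measurable_snd)).sub
      (hUm.measurable.comp measurable_fst)).enorm).pow_const p
  have hpt : ∀ x ∈ V, ‖U x‖ₑ ^ p
      ≤ 2 ^ (p - 1) * (M⁻¹ * ∫⁻ w in B, ‖U (x + w) - U x‖ₑ ^ p) + 2 ^ (p - 1) * S := by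
    intro x hx
    obtain ⟨c, hc, hxc⟩ : ∃ c ∈ C, dist x c < δ := by
      have := hC hx
      simpa using this
    have h1 := enorm_sub_average_rpow_le hUm hUi hp1 (b := s • ν) hδ hxc.le
    rw [← hℓ c u] at h1
    have h2 : ‖ℓ c u‖ₑ ^ p ≤ S :=
      Finset.single_le_sum (f := fun ℓ' : W1p Ω p →L[ℝ] ℝ => ‖ℓ' u‖ₑ ^ p) (fun _ _ => zero_le)
        (Finset.mem_image_of_mem ℓ (hCfin.mem_toFinset.2 hc))
    have h3 : ‖U x‖ₑ ≤ ‖U x - ℓ c u‖ₑ + ‖ℓ c u‖ₑ := by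
      simpa using enorm_add_le (U x - ℓ c u) (ℓ c u)
    calc ‖U x‖ₑ ^ p ≤ (‖U x - ℓ c u‖ₑ + ‖ℓ c u‖ₑ) ^ p := ENNReal.rpow_le_rpow h3 hp0.le
      _ ≤ 2 ^ (p - 1) * (‖U x - ℓ c u‖ₑ ^ p + ‖ℓ c u‖ₑ ^ p) :=
          ENNReal.rpow_add_le_mul_rpow_add_rpow _ _ hp1.le
      _ ≤ _ := by rw [← mul_add]; gcongr
  -- The cone condition keeps the segments from `V` in direction `w` inside `Ω`, so the jump of the
  -- zero extension at `∂Ω` is never crossed.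
  have htrans : ∀ w ∈ B, ∫⁻ x in V, ‖U (x + w) - U x‖ₑ ^ p
      ≤ ENNReal.ofReal ((2 * s) ^ p) * ‖u‖ₑ ^ p := by
    intro w hw
    rw [hBdef, mem_closedBall_iff_norm, h2δ] at hw
    refine ((isWeakGradient_ext hmeas u).lintegral_translate_le hGm hUi hGi hp1 hVo
      (H s hs hss₀ w hw)).trans ?_
    rw [extGrad, lintegral_indicator_enorm_rpow hmeas, ← ENNReal.ofReal_rpow_of_pos (by positivity)]
    gcongr
    · rw [← ofReal_norm]
      exact ENNReal.ofReal_le_ofReal (norm_le_of_mem_cone hν hκ1 hs hw)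
    · rw [← ofReal_norm, ← ofReal_norm]
      exact ENNReal.ofReal_le_ofReal (norm_grad_le u)
  have hvolB : M⁻¹ * volume B = 2 ^ N := by
    rw [hM, hBdef, Measure.addHaar_closedBall _ _ hδ.le,
      Measure.addHaar_closedBall _ _ (by positivity : 0 ≤ 2 * δ), mul_pow,
      ENNReal.ofReal_mul (by positivity), mul_assoc,
      ← Measure.addHaar_closedBall _ (0 : Euc N) hδ.le, mul_left_comm,
      ENNReal.inv_mul_cancel hM0 hMt, mul_one, finrank_euclideanSpace_fin,
      ENNReal.ofReal_pow (by norm_num)]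
    norm_num
  calc ∫⁻ x in V, ‖U x‖ₑ ^ p
      ≤ ∫⁻ x in V, (2 ^ (p - 1) * (M⁻¹ * ∫⁻ w in B, ‖U (x + w) - U x‖ₑ ^ p)
          + 2 ^ (p - 1) * S) := setLIntegral_mono' hVo.measurableSet hpt
    _ = 2 ^ (p - 1) * (M⁻¹ * ∫⁻ w in B, ∫⁻ x in V, ‖U (x + w) - U x‖ₑ ^ p)
          + 2 ^ (p - 1) * volume V * S := by
        rw [lintegral_add_right _ measurable_const, lintegral_const_mul _
          ((Measurable.lintegral_prod_right hpair).const_mul _), lintegral_const_mul _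
          (Measurable.lintegral_prod_right hpair), lintegral_lintegral_swap hpair.aemeasurable]
        simp only [lintegral_const, Measure.restrict_apply MeasurableSet.univ, Set.univ_inter]
        ring
    _ ≤ 2 ^ (p - 1) * (M⁻¹ * ∫⁻ w in B, ENNReal.ofReal ((2 * s) ^ p) * ‖u‖ₑ ^ p)
          + 2 ^ (p - 1) * volume V * S := by
        gcongr _ * (_ * ?_) + _
        exact setLIntegral_mono' Metric.isClosed_closedBall.measurableSet htrans
    _ = ENNReal.ofReal (2 ^ (p - 1) * 2 ^ N * (2 * s) ^ p) * ‖u‖ₑ ^ p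
          + 2 ^ (p - 1) * volume V * S := by
        rw [lintegral_const, Measure.restrict_apply MeasurableSet.univ, Set.univ_inter,
          mul_left_comm M⁻¹, hvolB, ENNReal.ofReal_mul (by positivity),
          ENNReal.ofReal_mul (by positivity),
          ← ENNReal.ofReal_rpow_of_pos (two_pos : (0 : ℝ) < 2),
          ENNReal.ofReal_pow (by norm_num), ENNReal.ofReal_ofNat]
        ring
    _ ≤ _ := add_le_add (mul_le_mul_left (ENNReal.ofReal_le_ofReal hsε) _) le_rfl

/-- Compactness of the closure patches the local estimates. The property is stated for every `ε`, so
that a union of two sets can spend `ε/2` on each. -/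
theorem exists_approximation (hΩ : IsOpen Ω) (hbdd : Bornology.IsBounded Ω)
    (hbdry : HasC2Boundary Ω) {ε : ℝ} (hε : 0 < ε) :
    ∃ (t : Finset (W1p Ω p →L[ℝ] ℝ)) (K : ℝ≥0∞), K ≠ ⊤ ∧ ∀ u : W1p Ω p,
      ‖fn u‖ₑ ^ p ≤ ENNReal.ofReal ε * ‖u‖ₑ ^ p + K * ∑ ℓ ∈ t, ‖ℓ u‖ₑ ^ p := by
  classical
  have hp0 : 0 < p := by linarith [hp.out]
  have key : ∀ ε : ℝ, 0 < ε → ∃ (t : Finset (W1p Ω p →L[ℝ] ℝ)) (K : ℝ≥0∞), K ≠ ⊤ ∧ ∀ u : W1p Ω p,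
      ∫⁻ x in Ω ∩ closure Ω, ‖ext u x‖ₑ ^ p
        ≤ ENNReal.ofReal ε * ‖u‖ₑ ^ p + K * ∑ ℓ ∈ t, ‖ℓ u‖ₑ ^ p := by
    refine hbdd.isCompact_closure.induction_on (p := fun S => ∀ ε : ℝ, 0 < ε →
      ∃ (t : Finset (W1p Ω p →L[ℝ] ℝ)) (K : ℝ≥0∞), K ≠ ⊤ ∧ ∀ u : W1p Ω p,
      ∫⁻ x in Ω ∩ S, ‖ext u x‖ₑ ^ p
        ≤ ENNReal.ofReal ε * ‖u‖ₑ ^ p + K * ∑ ℓ ∈ t, ‖ℓ u‖ₑ ^ p) ?_ ?_ ?_ ?_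
    · intro ε _
      exact ⟨∅, 0, by simp, fun u => by simp⟩
    · intro S T hST hT ε hε
      obtain ⟨t, K, hK, h⟩ := hT ε hε
      refine ⟨t, K, hK, fun u => (lintegral_mono_set ?_).trans (h u)⟩
      exact Set.inter_subset_inter_right _ hST
    · intro S T hS hT ε hε
      obtain ⟨t, K, hK, h⟩ := hS (ε / 2) (by positivity)
      obtain ⟨t', K', hK', h'⟩ := hT (ε / 2) (by positivity)
      refine ⟨t ∪ t', K + K', by simp [hK, hK'], fun u => ?_⟩
      rw [Set.inter_union_distrib_left]
      refine (lintegral_union_le _ _ _).trans ((add_le_add (h u) (h' u)).trans ?_)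
      have e : ENNReal.ofReal ε = ENNReal.ofReal (ε / 2) + ENNReal.ofReal (ε / 2) := by
        rw [← ENNReal.ofReal_add (by positivity) (by positivity), add_halves]
      have e1 : ∑ ℓ ∈ t, ‖ℓ u‖ₑ ^ p ≤ ∑ ℓ ∈ t ∪ t', ‖ℓ u‖ₑ ^ p :=
        Finset.sum_le_sum_of_subset Finset.subset_union_left
      have e2 : ∑ ℓ ∈ t', ‖ℓ u‖ₑ ^ p ≤ ∑ ℓ ∈ t ∪ t', ‖ℓ u‖ₑ ^ p :=
        Finset.sum_le_sum_of_subset Finset.subset_union_right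
      rw [e, add_mul, add_mul, add_add_add_comm]
      gcongr
    · intro x hx
      obtain ⟨r, hr, h⟩ := exists_local_approximation (p := p) hΩ hbdd
        (hasInwardCone_of_mem_closure hΩ hbdry hx)
      exact ⟨Metric.ball x r, mem_nhdsWithin_of_mem_nhds (Metric.ball_mem_nhds x hr), h⟩
  obtain ⟨t, K, hK, h⟩ := key ε hε
  refine ⟨t, K, hK, fun u => ?_⟩
  have h1 := h u
  rw [Set.inter_eq_left.2 subset_closure] at h1
  rw [← lintegral_enorm_rpow]
  refine le_trans (le_of_eq ?_) h1
  exact setLIntegral_congr_fun hΩ.measurableSet fun x hx => by simp [ext, hx]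

theorem exists_approximation_real (hΩ : IsOpen Ω) (hbdd : Bornology.IsBounded Ω)
    (hbdry : HasC2Boundary Ω) {ε : ℝ} (hε : 0 < ε) :
    ∃ (t : Finset (W1p Ω p →L[ℝ] ℝ)) (K : ℝ), 0 ≤ K ∧ ∀ u : W1p Ω p,
      ‖fn u‖ ^ p ≤ ε * ‖u‖ ^ p + K * ∑ ℓ ∈ t, |ℓ u| ^ p := by
  have hp0 : 0 < p := by linarith [hp.out]
  obtain ⟨t, K, hK, h⟩ := exists_approximation (p := p) hΩ hbdd hbdry hε
  refine ⟨t, K.toReal, ENNReal.toReal_nonneg, fun u => ?_⟩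
  have hs : ∑ ℓ ∈ t, ‖ℓ u‖ₑ ^ p = ENNReal.ofReal (∑ ℓ ∈ t, |ℓ u| ^ p) := by
    rw [ENNReal.ofReal_sum_of_nonneg fun _ _ => by positivity]
    refine Finset.sum_congr rfl fun ℓ _ => ?_
    rw [← ofReal_norm, ENNReal.ofReal_rpow_of_nonneg (norm_nonneg _) hp0.le, Real.norm_eq_abs]
  have h1 := h u
  rw [hs, ← ofReal_norm, ← ofReal_norm, ENNReal.ofReal_rpow_of_nonneg (norm_nonneg _) hp0.le,
    ENNReal.ofReal_rpow_of_nonneg (norm_nonneg _) hp0.le, ← ENNReal.ofReal_toReal hK,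
    ← ENNReal.ofReal_mul hε.le, ← ENNReal.ofReal_mul ENNReal.toReal_nonneg,
    ← ENNReal.ofReal_add (by positivity) (by positivity)] at h1
  exact (ENNReal.ofReal_le_ofReal_iff (by positivity)).1 h1

set_option maxHeartbeats 1000000 in
/-- The Rellich–Kondrachov theorem: bounded sets of `W^{1,p}(Ω)` are totally bounded in `Lᵖ(Ω)`. -/
theorem totallyBounded_image_fn (hΩ : IsOpen Ω) (hbdd : Bornology.IsBounded Ω)
    (hbdry : HasC2Boundary Ω) (R : ℝ) :
    TotallyBounded ((fn : W1p Ω p → _) '' Metric.closedBall 0 R) := by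
  classical
  have hp0 : 0 < p := by linarith [hp.out]
  refine Metric.totallyBounded_of_finite_discretization fun ε hε => ?_
  obtain ⟨η, hη, hηε⟩ : ∃ η > 0, η * (2 * R) ^ p < ε ^ p / 2 := by
    have hcont : Tendsto (fun η : ℝ => η * (2 * R) ^ p) (𝓝[>] 0) (𝓝 0) := by
      have : Tendsto (fun η : ℝ => η * (2 * R) ^ p) (𝓝 0) (𝓝 (0 * (2 * R) ^ p)) :=
        tendsto_id.mul_const _
      rw [zero_mul] at this
      exact this.mono_left nhdsWithin_le_nhds
    obtain ⟨η, h1, h2⟩ := ((hcont.eventually (gt_mem_nhds (by positivity : 0 < ε ^ p / 2))).and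
      self_mem_nhdsWithin).exists
    exact ⟨η, h2, h1⟩
  obtain ⟨t, K, hK, H⟩ := exists_approximation_real (p := p) hΩ hbdd hbdry hη
  obtain ⟨δ, hδ, hδε⟩ : ∃ δ > 0, K * (t.card * (2 * δ) ^ p) < ε ^ p / 2 := by
    have hcont : Tendsto (fun δ : ℝ => K * (t.card * (2 * δ) ^ p)) (𝓝[>] 0) (𝓝 0) := by
      have : ContinuousAt (fun δ : ℝ => K * (t.card * (2 * δ) ^ p)) 0 :=
        continuousAt_const.mul (continuousAt_const.mul
          ((continuousAt_const.mul continuousAt_id).rpow_const (Or.inr hp0.le)))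
      have h2 := this.tendsto
      simp only [mul_zero, Real.zero_rpow hp0.ne'] at h2
      exact h2.mono_left nhdsWithin_le_nhds
    obtain ⟨δ, h1, h2⟩ := ((hcont.eventually (gt_mem_nhds (by positivity : 0 < ε ^ p / 2))).and
      self_mem_nhdsWithin).exists
    exact ⟨δ, h2, h1⟩
  -- The image of the ball under finitely many functionals is totally bounded. A `δ`-net there
  -- discretizes the `Lᵖ` image: elements sharing a net point have functionals within `2δ`, hence
  -- are `ε`-close in `Lᵖ` by the choice of `η` and `δ`.
  set L : W1p Ω p →L[ℝ] (t → ℝ) := ContinuousLinearMap.pi fun ℓ => (ℓ : W1p Ω p →L[ℝ] ℝ) with hL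
  have hLb : TotallyBounded (L '' Metric.closedBall 0 R) :=
    ((L.lipschitz.isBounded_image Metric.isBounded_closedBall).isCompact_closure.totallyBounded).subset
      subset_closure
  obtain ⟨C, hC, hcov⟩ := Metric.totallyBounded_iff.1 hLb δ hδ
  have hex : ∀ y : ((fn : W1p Ω p → _) '' Metric.closedBall 0 R), ∃ (u : W1p Ω p) (c : C),
      ‖u‖ ≤ R ∧ fn u = y ∧ dist (L u) c < δ := by
    rintro ⟨_, u, hu, rfl⟩
    have := hcov (Set.mem_image_of_mem L hu)
    simp only [Set.mem_iUnion, Metric.mem_ball] at this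
    obtain ⟨c, hc, hd⟩ := this
    exact ⟨u, ⟨c, hc⟩, by simpa using hu, rfl, hd⟩
  choose U F hUR hUf hUF using hex
  refine ⟨C, hC.fintype, F, fun x y hxy => ?_⟩
  have hd : dist (L (U x)) (L (U y)) < 2 * δ := by
    have h1 := hUF x
    have h2 := hUF y
    rw [← hxy] at h2
    rw [two_mul]
    exact (dist_triangle_right _ _ _).trans_lt (add_lt_add h1 h2)
  have h1 := H (U x - U y)
  have h2 : ‖U x - U y‖ ≤ 2 * R := by linarith [norm_sub_le (U x) (U y), hUR x, hUR y]
  have h3 : ∀ ℓ ∈ t, |ℓ (U x - U y)| ^ p ≤ (2 * δ) ^ p := by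
    intro ℓ hℓ
    refine Real.rpow_le_rpow (abs_nonneg _) ?_ hp0.le
    have h4 := (dist_le_pi_dist (L (U x)) (L (U y)) ⟨ℓ, hℓ⟩).trans hd.le
    simpa [hL, Real.dist_eq] using h4
  have h5 : ∑ ℓ ∈ t, |ℓ (U x - U y)| ^ p ≤ t.card * (2 * δ) ^ p := by
    simpa using Finset.sum_le_card_nsmul _ _ _ h3
  have h6 : ‖U x - U y‖ ^ p ≤ (2 * R) ^ p := Real.rpow_le_rpow (norm_nonneg _) h2 hp0.le
  have h7 : ‖fn (U x - U y)‖ ^ p < ε ^ p := by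
    have := mul_le_mul_of_nonneg_left h6 hη.le
    have := mul_le_mul_of_nonneg_left h5 hK
    linarith
  rw [← hUf x, ← hUf y, dist_eq_norm]
  exact (Real.rpow_lt_rpow_iff (norm_nonneg _) hε.le hp0).1 h7

theorem exists_subseq_tendsto_fn (hΩ : IsOpen Ω) (hbdd : Bornology.IsBounded Ω)
    (hbdry : HasC2Boundary Ω) {R : ℝ} {u : ℕ → W1p Ω p} (hu : ∀ n, ‖u n‖ ≤ R) :
    ∃ k : ℕ → ℕ, StrictMono k ∧ ∃ y, Tendsto (fun n => fn (u (k n))) atTop (𝓝 y) := by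
  have hc : IsCompact (closure ((fn : W1p Ω p → _) '' Metric.closedBall 0 R)) :=
    (totallyBounded_image_fn (p := p) hΩ hbdd hbdry R).closure.isCompact_of_isClosed isClosed_closure
  obtain ⟨y, _, k, hk, hy⟩ := hc.tendsto_subseq (x := fun n => fn (u n)) fun n =>
    subset_closure ⟨u n, by simpa using hu n, rfl⟩
  exact ⟨k, hk, y, hy⟩

end LocalApproximation

/-! ### Superposition operators and differentiability of integral functionals -/

section Superposition

variable {α : Type*} [MeasurableSpace α] {μ : Measure α}
  {E : Type*} [NormedAddCommGroup E]

/-- Structural conditions under which `u ↦ h(·, u(·))` maps `Lᵖ` continuously into `L^{p'}`. -/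
structure IsNemytskii (μ : Measure α) (p p' : ℝ) (h : α → E → E) : Prop where
  aestronglyMeasurable : ∀ u : α → E, AEStronglyMeasurable u μ →
    AEStronglyMeasurable (fun z => h z (u z)) μ
  continuous : ∀ᵐ z ∂μ, Continuous (h z)
  growth : ∃ (a : α → ℝ) (C : ℝ), MemLp a (ENNReal.ofReal p') μ ∧ (∀ z, 0 ≤ a z) ∧ 0 ≤ C ∧
    ∀ᵐ z ∂μ, ∀ x, ‖h z x‖ ≤ a z + C * ‖x‖ ^ (p - 1)

variable {p p' : ℝ}

theorem memLp_norm_rpow_sub_one {F : Type*} [NormedAddCommGroup F] (hpp : p.HolderConjugate p')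
    {u : α → F} (hu : MemLp u (ENNReal.ofReal p) μ) :
    MemLp (fun z => ‖u z‖ ^ (p - 1)) (ENNReal.ofReal p') μ := by
  have h := hu.norm_rpow_div (ENNReal.ofReal (p - 1))
  have hp1 : 0 < p - 1 := by linarith [hpp.lt]
  rw [ENNReal.toReal_ofReal hp1.le, ← ENNReal.ofReal_div_of_pos hp1] at h
  rwa [hpp.conjugate_eq]

theorem memLp_integrable_mul (hpp : p.HolderConjugate p') {f g : α → ℝ}
    (hf : MemLp f (ENNReal.ofReal p') μ) (hg : MemLp g (ENNReal.ofReal p) μ) :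
    Integrable (fun z => f z * g z) μ := by
  have : (ENNReal.ofReal p').HolderConjugate (ENNReal.ofReal p) := hpp.symm.ennrealOfReal
  exact hf.integrable_mul hg

theorem memLp_growth {F : Type*} [NormedAddCommGroup F] (hpp : p.HolderConjugate p')
    {a : α → ℝ} (ha : MemLp a (ENNReal.ofReal p') μ) (C : ℝ)
    {u : α → F} (hu : MemLp u (ENNReal.ofReal p) μ) :
    MemLp (fun z => a z + C * ‖u z‖ ^ (p - 1)) (ENNReal.ofReal p') μ :=
  ha.add ((memLp_norm_rpow_sub_one hpp hu).const_mul C)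

theorem IsNemytskii.memLp {h : α → E → E} (hN : IsNemytskii μ p p' h)
    (hpp : p.HolderConjugate p') {u : α → E} (hu : MemLp u (ENNReal.ofReal p) μ) :
    MemLp (fun z => h z (u z)) (ENNReal.ofReal p') μ := by
  obtain ⟨a, C, ha, _, _, hg⟩ := hN.growth
  refine (memLp_growth hpp ha C hu).mono' (hN.aestronglyMeasurable u hu.1) ?_
  filter_upwards [hg] with z hz using hz _

/-- The superposition operator. -/
noncomputable def IsNemytskii.map {h : α → E → E} (hN : IsNemytskii μ p p' h)
    (hpp : p.HolderConjugate p') (u : Lp E (ENNReal.ofReal p) μ) : Lp E (ENNReal.ofReal p') μ :=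
  (hN.memLp hpp (Lp.memLp u)).toLp

theorem IsNemytskii.coeFn_map {h : α → E → E} (hN : IsNemytskii μ p p' h)
    (hpp : p.HolderConjugate p') (u : Lp E (ENNReal.ofReal p) μ) :
    hN.map hpp u =ᵐ[μ] fun z => h z (u z) := MemLp.coeFn_toLp _

/-- Dominated convergence with a convergent sequence of dominating functions. -/
theorem tendsto_lintegral_zero_of_le_add {f g : ℕ → α → ℝ≥0∞} {Ψ : α → ℝ≥0∞}
    (hf : ∀ n, AEMeasurable (f n) μ) (hg : ∀ n, AEMeasurable (g n) μ)
    (hfg : ∀ n, ∀ᵐ z ∂μ, f n z ≤ Ψ z + g n z) (hΨ : ∫⁻ z, Ψ z ∂μ ≠ ⊤)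
    (hf0 : ∀ᵐ z ∂μ, Tendsto (fun n => f n z) atTop (𝓝 0))
    (hg0 : Tendsto (fun n => ∫⁻ z, g n z ∂μ) atTop (𝓝 0)) :
    Tendsto (fun n => ∫⁻ z, f n z ∂μ) atTop (𝓝 0) := by
  -- The subtraction is truncated at zero, so `f n - g n` is dominated by the fixed `Ψ` and tends to
  -- zero pointwise, whatever `g n` does pointwise.
  have h1 : Tendsto (fun n => ∫⁻ z, (f n z - g n z) ∂μ) atTop (𝓝 (∫⁻ _, 0 ∂μ)) := by
    refine tendsto_lintegral_of_dominated_convergence' Ψ (fun n => (hf n).sub (hg n)) ?_ hΨ ?_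
    · intro n
      filter_upwards [hfg n] with z hz using tsub_le_iff_right.2 hz
    · filter_upwards [hf0] with z hz
      exact tendsto_of_tendsto_of_tendsto_of_le_of_le tendsto_const_nhds hz
        (fun _ => zero_le) (fun _ => tsub_le_self)
  have h2 := h1.add hg0
  simp only [lintegral_zero, add_zero] at h2
  refine tendsto_of_tendsto_of_tendsto_of_le_of_le tendsto_const_nhds h2 (fun _ => zero_le) ?_
  intro n
  beta_reduce
  rw [← lintegral_add_right' _ (hg n)]
  exact lintegral_mono fun z => le_tsub_add

variable [hp : Fact (1 < p)]

theorem tendsto_Lp_iff_lintegral {F : Type*} [NormedAddCommGroup F]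
    {u : ℕ → Lp F (ENNReal.ofReal p) μ} {v : Lp F (ENNReal.ofReal p) μ} :
    Tendsto u atTop (𝓝 v) ↔ Tendsto (fun n => ∫⁻ z, ‖u n z - v z‖ₑ ^ p ∂μ) atTop (𝓝 0) := by
  have hp0 : 0 < p := by linarith [hp.out]
  have h1 : ∀ n, ∫⁻ z, ‖u n z - v z‖ₑ ^ p ∂μ = ‖u n - v‖ₑ ^ p := by
    intro n
    rw [← lintegral_enorm_rpow]
    apply lintegral_congr_ae
    filter_upwards [Lp.coeFn_sub (u n) v] with z hz
    rw [hz, Pi.sub_apply]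
  simp only [h1]
  rw [tendsto_iff_edist_tendsto_0]
  simp only [edist_eq_enorm_sub]
  constructor
  · intro h
    simpa [ENNReal.zero_rpow_of_pos hp0] using h.ennrpow_const p
  · intro h
    have := h.ennrpow_const (1 / p)
    simpa [← ENNReal.rpow_mul, hp0.ne', ENNReal.zero_rpow_of_pos (inv_pos.2 hp0)] using this

/-- Every subsequence has a further one converging almost everywhere, along which `h(z, ·)` may be
composed by continuity. The growth bound dominates by a fixed integrable function plus a multiple of
`‖wₙ - v‖^p`, whose integral tends to zero; here `(p-1)p' = p`. -/
theorem IsNemytskii.continuous_map [hp' : Fact (1 < p')] {h : α → E → E}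
    (hN : IsNemytskii μ p p' h)
    (hpp : p.HolderConjugate p') : Continuous (hN.map hpp) := by
  have hp1 := hp.out
  have hp1' := hp'.out
  have hpm : 0 < p - 1 := by linarith
  have hp0' : 0 < p' := by linarith
  rw [continuous_iff_seqContinuous]
  intro u v huv
  refine tendsto_of_subseq_tendsto fun ns hns => ?_
  have huv' := huv.comp hns
  obtain ⟨ms, hms, hae⟩ := (tendstoInMeasure_of_tendsto_Lp huv').exists_seq_tendsto_ae
  refine ⟨ms, ?_⟩
  set w : ℕ → Lp E (ENNReal.ofReal p) μ := fun n => u (ns (ms n)) with hw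
  have hwv : Tendsto w atTop (𝓝 v) := huv'.comp hms.tendsto_atTop
  have hwv' := tendsto_Lp_iff_lintegral.1 hwv
  change Tendsto (fun n => hN.map hpp (w n)) atTop (𝓝 (hN.map hpp v))
  rw [tendsto_Lp_iff_lintegral]
  obtain ⟨a, C, ha, ha0, hC0, hg⟩ := hN.growth
  set K₁ : ℝ≥0∞ := 2 ^ (p' - 1) with hK₁
  set K₂ : ℝ≥0∞ := 2 ^ (p - 1) with hK₂
  have hK₁t : K₁ ≠ ⊤ := ENNReal.rpow_ne_top_of_nonneg (by linarith) (by simp)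
  have hK₂t : K₂ ≠ ⊤ := ENNReal.rpow_ne_top_of_nonneg (by linarith) (by simp)
  set c : ℝ≥0∞ := ENNReal.ofReal C ^ p' with hc
  have hct : c ≠ ⊤ := ENNReal.rpow_ne_top_of_nonneg (by linarith) (by simp)
  set A : α → ℝ := fun z => (a z + a z) + C * ‖v z‖ ^ (p - 1) with hA
  have hAm : MemLp A (ENNReal.ofReal p') μ := memLp_growth hpp (ha.add ha) C (Lp.memLp v)
  have hA0 : ∀ z, 0 ≤ A z := fun z => by have := ha0 z; positivity
  have hmeas : ∀ n, AEMeasurable (fun z => ‖w n z - v z‖ₑ ^ p) μ := fun n =>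
    ((Lp.aestronglyMeasurable (w n)).sub (Lp.aestronglyMeasurable v)).enorm.pow_const p
  refine tendsto_lintegral_zero_of_le_add
    (g := fun n z => K₁ * (c * (K₂ * ‖w n z - v z‖ₑ ^ p)))
    (Ψ := fun z => K₁ * (‖A z‖ₑ ^ p' + c * (K₂ * ‖v z‖ₑ ^ p))) ?_ ?_ ?_ ?_ ?_ ?_
  · intro n
    exact ((Lp.aestronglyMeasurable _).sub (Lp.aestronglyMeasurable _)).enorm.pow_const p'
  · intro n
    exact (((hmeas n).const_mul _).const_mul _).const_mul _
  · intro n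
    filter_upwards [hg, hN.coeFn_map hpp (w n), hN.coeFn_map hpp v] with z hz h1 h2
    rw [h1, h2]
    have e1 : ‖h z (w n z) - h z (v z)‖ ≤ A z + C * ‖w n z‖ ^ (p - 1) := by
      have := norm_sub_le (h z (w n z)) (h z (v z))
      simp only [hA]
      linarith [hz (w n z), hz (v z)]
    have e2 : ‖h z (w n z) - h z (v z)‖ₑ ≤ ‖A z‖ₑ + ENNReal.ofReal C * ‖w n z‖ₑ ^ (p - 1) := by
      rw [← ofReal_norm, ← ofReal_norm, ← ofReal_norm, Real.norm_of_nonneg (hA0 z),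
        ENNReal.ofReal_rpow_of_nonneg (norm_nonneg _) hpm.le, ← ENNReal.ofReal_mul hC0,
        ← ENNReal.ofReal_add (hA0 z) (by positivity)]
      exact ENNReal.ofReal_le_ofReal e1
    have e3 : (ENNReal.ofReal C * ‖w n z‖ₑ ^ (p - 1)) ^ p' = c * ‖w n z‖ₑ ^ p := by
      rw [ENNReal.mul_rpow_of_nonneg _ _ hp0'.le, ← ENNReal.rpow_mul, hpp.sub_one_mul_conj]
    have e4 : ‖w n z‖ₑ ^ p ≤ K₂ * (‖v z‖ₑ ^ p + ‖w n z - v z‖ₑ ^ p) := by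
      refine le_trans (ENNReal.rpow_le_rpow ?_ (by linarith)) (ENNReal.rpow_add_le_mul_rpow_add_rpow _ _ hp1.le)
      simpa using enorm_add_le (v z) (w n z - v z)
    calc ‖h z (w n z) - h z (v z)‖ₑ ^ p'
        ≤ (‖A z‖ₑ + ENNReal.ofReal C * ‖w n z‖ₑ ^ (p - 1)) ^ p' :=
          ENNReal.rpow_le_rpow e2 hp0'.le
      _ ≤ K₁ * (‖A z‖ₑ ^ p' + c * ‖w n z‖ₑ ^ p) := by
          rw [← e3]; exact ENNReal.rpow_add_le_mul_rpow_add_rpow _ _ hp1'.le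
      _ ≤ K₁ * (‖A z‖ₑ ^ p' + c * (K₂ * (‖v z‖ₑ ^ p + ‖w n z - v z‖ₑ ^ p))) := by gcongr
      _ = _ := by ring
  · have hAi : ∫⁻ z, ‖A z‖ₑ ^ p' ∂μ ≠ ⊤ := by
      have := lintegral_rpow_enorm_lt_top_of_eLpNorm_lt_top (by simpa using hp0') (by simp)
        hAm.eLpNorm_lt_top
      rw [toReal_ofReal_exponent] at this
      exact this.ne
    have hvi : ∫⁻ z, ‖v z‖ₑ ^ p ∂μ ≠ ⊤ := by
      rw [lintegral_enorm_rpow]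
      exact ENNReal.rpow_ne_top_of_nonneg (by linarith) (by simp)
    have hvm : AEMeasurable (fun z => ‖v z‖ₑ ^ p) μ :=
      (Lp.aestronglyMeasurable v).enorm.pow_const p
    rw [lintegral_const_mul' _ _ hK₁t,
      lintegral_add_right' _ ((hvm.const_mul _).const_mul _),
      lintegral_const_mul' _ _ hct, lintegral_const_mul' _ _ hK₂t]
    exact ENNReal.mul_ne_top hK₁t (ENNReal.add_ne_top.2
      ⟨hAi, ENNReal.mul_ne_top hct (ENNReal.mul_ne_top hK₂t hvi)⟩)
  · have hall : ∀ᵐ z ∂μ, ∀ n, hN.map hpp (w n) z = h z (w n z) :=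
      ae_all_iff.2 fun n => hN.coeFn_map hpp (w n)
    filter_upwards [hall, hN.coeFn_map hpp v, hN.continuous, hae] with z h1 h2 h3 h4
    simp only [h1, h2]
    have h5 : Tendsto (fun n => h z (w n z)) atTop (𝓝 (h z (v z))) := (h3.tendsto _).comp h4
    have h6 := ((h5.sub_const (h z (v z))).enorm).ennrpow_const p'
    simpa [ENNReal.zero_rpow_of_pos hp0'] using h6
  · have e : ∀ n, ∫⁻ z, K₁ * (c * (K₂ * ‖w n z - v z‖ₑ ^ p)) ∂μ
        = K₁ * c * K₂ * ∫⁻ z, ‖w n z - v z‖ₑ ^ p ∂μ := by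
      intro n
      rw [lintegral_const_mul' _ _ hK₁t, lintegral_const_mul' _ _ hct,
        lintegral_const_mul' _ _ hK₂t]
      ring
    simp only [e]
    have := ENNReal.Tendsto.const_mul (a := K₁ * c * K₂) hwv'
      (Or.inr (ENNReal.mul_ne_top (ENNReal.mul_ne_top hK₁t hct) hK₂t))
    simpa using this

variable [InnerProductSpace ℝ E]

/-- `H(z, ·)` is a potential of `h(z, ·)`, vanishing at the origin. -/
structure IsPotential (μ : Measure α) (h : α → E → E) (H : α → E → ℝ) : Prop where
  aestronglyMeasurable : ∀ u : α → E, AEStronglyMeasurable u μ →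
    AEStronglyMeasurable (fun z => H z (u z)) μ
  hasFDerivAt : ∀ᵐ z ∂μ, ∀ x, HasFDerivAt (H z) (innerSL ℝ (h z x)) x
  zero : ∀ᵐ z ∂μ, H z 0 = 0

/-- The mean value inequality on `t ↦ H(z, t u(z))` bounds `|H(z, u)|` by `(a + C‖u‖^(p-1))‖u‖`, a
product of an `L^{p'}` and an `Lᵖ` function. -/
theorem IsPotential.integrable {h : α → E → E} {H : α → E → ℝ} (hN : IsNemytskii μ p p' h)
    (hH : IsPotential μ h H) (hpp : p.HolderConjugate p') {u : α → E}
    (hu : MemLp u (ENNReal.ofReal p) μ) : Integrable (fun z => H z (u z)) μ := by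
  have hpm : 0 ≤ p - 1 := by linarith [hp.out]
  obtain ⟨a, C, ha, ha0, hC0, hg⟩ := hN.growth
  refine (memLp_integrable_mul hpp (memLp_growth hpp ha C hu) hu.norm).mono'
    (hH.aestronglyMeasurable u hu.1) ?_
  filter_upwards [hg, hH.hasFDerivAt, hH.zero] with z hz hd h0
  have h1 := norm_image_sub_le_of_norm_deriv_le_segment_01'
    (f := fun t : ℝ => H z (t • u z)) (f' := fun t => inner ℝ (h z (t • u z)) (u z))
    (C := (a z + C * ‖u z‖ ^ (p - 1)) * ‖u z‖) ?_ ?_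
  · simpa [h0] using h1
  · intro t _
    have h2 := (hd (t • u z)).comp_hasDerivAt t ((hasDerivAt_id t).smul_const (u z))
    simpa using! h2.hasDerivWithinAt
  · intro t ht
    refine (norm_inner_le_norm _ _).trans (mul_le_mul_of_nonneg_right ?_ (norm_nonneg _))
    refine (hz _).trans ?_
    have : ‖t • u z‖ ≤ ‖u z‖ := by
      rw [norm_smul, Real.norm_of_nonneg ht.1]
      exact mul_le_of_le_one_left (norm_nonneg _) ht.2.le
    gcongr

theorem IsPotential.hasDerivAt_line {h : α → E → E} {H : α → E → ℝ} (hN : IsNemytskii μ p p' h)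
    (hH : IsPotential μ h H) (hpp : p.HolderConjugate p') {u w : α → E}
    (hu : MemLp u (ENNReal.ofReal p) μ) (hw : MemLp w (ENNReal.ofReal p) μ) (t : ℝ) :
    HasDerivAt (fun s : ℝ => ∫ z, H z (u z + s • w z) ∂μ)
      (∫ z, inner ℝ (h z (u z + t • w z)) (w z) ∂μ) t := by
  have hpm : 0 ≤ p - 1 := by linarith [hp.out]
  obtain ⟨a, C, ha, ha0, hC0, hg⟩ := hN.growth
  have hR : MemLp (fun z => ‖u z‖ + (|t| + 1) * ‖w z‖) (ENNReal.ofReal p) μ :=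
    hu.norm.add (hw.norm.const_mul _)
  have hline : ∀ s : ℝ, MemLp (fun z => u z + s • w z) (ENNReal.ofReal p) μ := fun s =>
    hu.add (hw.const_smul s)
  refine (hasDerivAt_integral_of_dominated_loc_of_deriv_le (s := Metric.ball t 1)
    (F' := fun s z => inner ℝ (h z (u z + s • w z)) (w z))
    -- For `s` within distance `1` of `t` one has `|s| ≤ |t| + 1`; the outer norm lets
    -- `memLp_growth` apply.
    (bound := fun z => (a z + C * ‖‖u z‖ + (|t| + 1) * ‖w z‖‖ ^ (p - 1)) * ‖w z‖)
    (Metric.ball_mem_nhds t one_pos) ?_ ?_ ?_ ?_ ?_ ?_).2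
  · exact Eventually.of_forall fun s => hH.aestronglyMeasurable _ (hline s).1
  · exact hH.integrable hN hpp (hline t)
  · exact (hN.aestronglyMeasurable _ (hline t).1).inner hw.1
  · filter_upwards [hg] with z hz s hs
    refine (norm_inner_le_norm _ _).trans (mul_le_mul_of_nonneg_right ?_ (norm_nonneg _))
    refine (hz _).trans ?_
    have hs1 : |s| ≤ |t| + 1 := by
      rw [Metric.mem_ball, Real.dist_eq] at hs
      have := abs_sub_abs_le_abs_sub s t
      linarith
    have : ‖u z + s • w z‖ ≤ ‖‖u z‖ + (|t| + 1) * ‖w z‖‖ := by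
      rw [Real.norm_of_nonneg (by positivity)]
      refine (norm_add_le _ _).trans ?_
      rw [norm_smul, Real.norm_eq_abs]
      gcongr
    gcongr
  · exact memLp_integrable_mul hpp (memLp_growth hpp ha C hR) hw.norm
  · filter_upwards [hH.hasFDerivAt] with z hd s _
    have h2 := (hd (u z + s • w z)).comp_hasDerivAt s
      (((hasDerivAt_id s).smul_const (w z)).const_add (u z))
    simpa using! h2

variable [hp' : Fact (1 < p')]

/-- A function with a continuous Gateaux derivative is continuously differentiable. -/
theorem hasFDerivAt_of_continuous_gateaux {X : Type*} [NormedAddCommGroup X] [NormedSpace ℝ X]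
    {φ : X → ℝ} {φ' : X → X →L[ℝ] ℝ} (hc : Continuous φ')
    (hd : ∀ (u w : X) (t : ℝ), HasDerivAt (fun s : ℝ => φ (u + s • w)) (φ' (u + t • w) w) t)
    (u : X) : HasFDerivAt φ (φ' u) u := by
  rw [hasFDerivAt_iff_isLittleO_nhds_zero, Asymptotics.isLittleO_iff]
  intro ε hε
  obtain ⟨δ, hδ, H⟩ := Metric.continuous_iff.1 hc u ε hε
  filter_upwards [Metric.ball_mem_nhds (0 : X) hδ] with w hw
  rw [mem_ball_zero_iff] at hw
  -- Mean value inequality for `φ(u + tw)` minus its linearization: the derivative is at most `ε‖w‖`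
  -- on the whole segment by continuity of `φ'` at `u`.
  have h1 := norm_image_sub_le_of_norm_deriv_le_segment_01'
    (f := fun t : ℝ => φ (u + t • w) - t * φ' u w)
    (f' := fun t => φ' (u + t • w) w - 1 * φ' u w)
    (C := ε * ‖w‖) ?_ ?_
  · simp only [one_smul, zero_smul, add_zero, zero_mul, one_mul, sub_zero] at h1
    rwa [sub_right_comm] at h1
  · intro t _
    exact ((hd u w t).sub ((hasDerivAt_id t).mul_const _)).hasDerivWithinAt
  · intro t ht
    rw [one_mul, ← sub_apply]
    refine (ContinuousLinearMap.le_opNorm _ _).trans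
      (mul_le_mul_of_nonneg_right ?_ (norm_nonneg _))
    rw [← dist_eq_norm]
    refine (H _ ?_).le
    rw [dist_eq_norm, add_sub_cancel_left, norm_smul, Real.norm_of_nonneg ht.1]
    exact (mul_le_of_le_one_left (norm_nonneg _) ht.2.le).trans_lt hw

/-- The `L^{p'}`–`Lᵖ` pairing turns the continuous superposition map into a continuous dual-valued
map `D`; differentiation under the integral along lines identifies `D` as the Gateaux derivative. -/
theorem IsPotential.contDiff {h : α → E → E} {H : α → E → ℝ} (hN : IsNemytskii μ p p' h)
    (hH : IsPotential μ h H) (hpp : p.HolderConjugate p') :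
    ∃ D : Lp E (ENNReal.ofReal p) μ → Lp E (ENNReal.ofReal p) μ →L[ℝ] ℝ, Continuous D ∧
      (∀ u w, D u w = ∫ z, inner ℝ (h z (u z)) (w z) ∂μ) ∧
      ∀ u, HasFDerivAt (fun u : Lp E (ENNReal.ofReal p) μ => ∫ z, H z (u z) ∂μ) (D u) u := by
  have : (ENNReal.ofReal p').HolderConjugate (ENNReal.ofReal p) := hpp.symm.ennrealOfReal
  set B := (innerSL ℝ : E →L[ℝ] E →L[ℝ] ℝ).lpPairing μ (ENNReal.ofReal p') (ENNReal.ofReal p)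
    with hB
  set D : Lp E (ENNReal.ofReal p) μ → Lp E (ENNReal.ofReal p) μ →L[ℝ] ℝ :=
    fun u => B (hN.map hpp u) with hD
  have hDc : Continuous D := B.continuous.comp (hN.continuous_map hpp)
  have hDe : ∀ u w, D u w = ∫ z, inner ℝ (h z (u z)) (w z) ∂μ := by
    intro u w
    rw [hD, hB, ContinuousLinearMap.lpPairing_eq_integral]
    apply integral_congr_ae
    filter_upwards [hN.coeFn_map hpp u] with z hz
    rw [hz]
    rfl
  refine ⟨D, hDc, hDe, hasFDerivAt_of_continuous_gateaux hDc fun u w t => ?_⟩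
  have hline : ∀ s : ℝ, ⇑(u + s • w) =ᵐ[μ] fun z => u z + s • w z := by
    intro s
    filter_upwards [Lp.coeFn_add u (s • w), Lp.coeFn_smul s w] with z h1 h2
    rw [h1, Pi.add_apply, h2, Pi.smul_apply]
  have h1 := hH.hasDerivAt_line hN hpp (Lp.memLp u) (Lp.memLp w) t
  have h2 : D (u + t • w) w = ∫ z, inner ℝ (h z (u z + t • w z)) (w z) ∂μ := by
    rw [hDe]
    apply integral_congr_ae
    filter_upwards [hline t] with z hz
    rw [hz]
  have h3 : (fun s : ℝ => ∫ z, H z ((u + s • w) z) ∂μ)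
      = fun s : ℝ => ∫ z, H z (u z + s • w z) ∂μ := by
    ext s
    apply integral_congr_ae
    filter_upwards [hline s] with z hz
    rw [hz]
  rw [h2]
  exact h3 ▸ h1

end Superposition

/-! ### Monotonicity of `x ↦ |x|^{p-2} x` -/

section DualityMap

variable {E : Type*} [NormedAddCommGroup E] [InnerProductSpace ℝ E] {p : ℝ}

/-- The map `x ↦ |x|^{p-2} x`, the gradient of `|x|^p / p`. -/
noncomputable def powMap (p : ℝ) (x : E) : E := ‖x‖ ^ (p - 2) • x

theorem rpow_sub_two_mul_self (hp : 1 < p) {a : ℝ} (ha : 0 ≤ a) :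
    a ^ (p - 2) * a = a ^ (p - 1) := by
  rcases ha.eq_or_lt with rfl | ha
  · rw [mul_zero, Real.zero_rpow (by linarith)]
  · rw [← Real.rpow_add_one ha.ne']; ring_nf

theorem rpow_sub_one_mul_self (hp : 1 < p) {a : ℝ} (ha : 0 ≤ a) : a ^ (p - 1) * a = a ^ p := by
  rcases ha.eq_or_lt with rfl | ha
  · rw [mul_zero, Real.zero_rpow (by linarith)]
  · rw [← Real.rpow_add_one ha.ne']; ring_nf

theorem norm_powMap (hp : 1 < p) (x : E) : ‖powMap p x‖ = ‖x‖ ^ (p - 1) := by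
  rw [powMap, norm_smul, Real.norm_of_nonneg (by positivity),
    rpow_sub_two_mul_self hp (norm_nonneg _)]

theorem continuous_powMap (hp : 1 < p) : Continuous (powMap p : E → E) := by
  rw [continuous_iff_continuousAt]
  intro x
  by_cases hx : x = 0
  · subst hx
    have h0 : powMap p (0 : E) = 0 := by simp [powMap]
    rw [ContinuousAt, h0, tendsto_zero_iff_norm_tendsto_zero]
    simp only [norm_powMap hp]
    have : ContinuousAt (fun x : E => ‖x‖ ^ (p - 1)) 0 :=
      continuousAt_id.norm.rpow_const (Or.inr (by linarith))
    have h := this.tendsto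
    rwa [norm_zero, Real.zero_rpow (by linarith)] at h
  · exact (continuousAt_id.norm.rpow_const (Or.inl (norm_ne_zero_iff.2 hx))).smul continuousAt_id

theorem powMap_smul (hp : 1 < p) {t : ℝ} (ht : 0 ≤ t) (x : E) :
    powMap p (t • x) = t ^ (p - 1) • powMap p x := by
  rw [powMap, powMap, norm_smul, Real.norm_of_nonneg ht, Real.mul_rpow ht (norm_nonneg _),
    smul_smul, smul_smul, ← rpow_sub_two_mul_self hp ht]
  ring_nf

theorem inner_powMap_self (hp : 1 < p) (x : E) : inner ℝ (powMap p x) x = ‖x‖ ^ p := by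
  rw [powMap, real_inner_smul_left, real_inner_self_eq_norm_sq, pow_two, ← mul_assoc,
    rpow_sub_two_mul_self hp (norm_nonneg _), rpow_sub_one_mul_self hp (norm_nonneg _)]

/-- Cauchy–Schwarz bounds the pairing below by the radial part `(a^(p-1) - b^(p-1))(a - b)` with `a
= ‖x‖`, `b = ‖y‖`, positive when `a ≠ b`. When `a = b` the pairing equals `a^(p-2)‖x - y‖²`. -/
theorem inner_powMap_sub_nonneg_and_pos (hp : 1 < p) (x y : E) :
    0 ≤ inner ℝ (powMap p x - powMap p y) (x - y) ∧
      (x ≠ y → 0 < inner ℝ (powMap p x - powMap p y) (x - y)) := by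
  set a := ‖x‖ with ha
  set b := ‖y‖ with hb
  have ha0 : 0 ≤ a := norm_nonneg _
  have hb0 : 0 ≤ b := norm_nonneg _
  have e : inner ℝ (powMap p x - powMap p y) (x - y)
      = a ^ p + b ^ p - (a ^ (p - 2) + b ^ (p - 2)) * inner ℝ x y := by
    rw [inner_sub_left, inner_sub_right, inner_sub_right, inner_powMap_self hp,
      inner_powMap_self hp, powMap, powMap, real_inner_smul_left, real_inner_smul_left,
      real_inner_comm x y]
    ring
  have hsplit : a ^ p + b ^ p - (a ^ (p - 2) + b ^ (p - 2)) * (a * b)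
      = (a ^ (p - 1) - b ^ (p - 1)) * (a - b) := by
    have h1 := rpow_sub_one_mul_self hp ha0
    have h2 := rpow_sub_one_mul_self hp hb0
    have h3 := rpow_sub_two_mul_self hp ha0
    have h4 := rpow_sub_two_mul_self hp hb0
    rw [← h1, ← h2, ← h3, ← h4]
    ring
  have hcs : (a ^ (p - 2) + b ^ (p - 2)) * inner ℝ x y
      ≤ (a ^ (p - 2) + b ^ (p - 2)) * (a * b) :=
    mul_le_mul_of_nonneg_left (real_inner_le_norm x y) (by positivity)
  rcases lt_trichotomy a b with hab | hab | hab
  · have h1 : a ^ (p - 1) < b ^ (p - 1) := Real.rpow_lt_rpow ha0 hab (by linarith)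
    have h2 : 0 < (a ^ (p - 1) - b ^ (p - 1)) * (a - b) :=
      mul_pos_of_neg_of_neg (by linarith) (by linarith)
    rw [e]
    exact ⟨by linarith, fun _ => by linarith⟩
  · have h1 : inner ℝ (powMap p x - powMap p y) (x - y) = a ^ (p - 2) * ‖x - y‖ ^ 2 := by
      rw [e, ← hab, ← rpow_sub_one_mul_self hp ha0, ← rpow_sub_two_mul_self hp ha0,
        norm_sub_sq_real, ← ha, ← hb, ← hab]
      ring
    rw [h1]
    refine ⟨by positivity, fun hxy => ?_⟩
    have ha' : 0 < a := by
      rcases ha0.eq_or_lt with h | h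
      · exfalso
        apply hxy
        rw [norm_eq_zero.1 (ha.symm.trans h.symm), norm_eq_zero.1 (hb.symm.trans (hab.symm.trans h.symm))]
      · exact h
    have : 0 < ‖x - y‖ := norm_pos_iff.2 (sub_ne_zero.2 hxy)
    positivity
  · have h1 : b ^ (p - 1) < a ^ (p - 1) := Real.rpow_lt_rpow hb0 hab (by linarith)
    have h2 : 0 < (a ^ (p - 1) - b ^ (p - 1)) * (a - b) :=
      mul_pos (by linarith) (by linarith)
    rw [e]
    exact ⟨by linarith, fun _ => by linarith⟩

theorem inner_powMap_sub_nonneg (hp : 1 < p) (x y : E) :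
    0 ≤ inner ℝ (powMap p x - powMap p y) (x - y) := (inner_powMap_sub_nonneg_and_pos hp x y).1

/-- Quantitative strict monotonicity of `x ↦ |x|^{p-2} x`. -/
theorem exists_norm_sub_rpow_le [FiniteDimensional ℝ E] (hp : 1 < p) {ε : ℝ} (hε : 0 < ε) :
    ∃ C : ℝ, 0 ≤ C ∧ ∀ x y : E, ‖x - y‖ ^ p
      ≤ ε * (‖x‖ ^ p + ‖y‖ ^ p) + C * inner ℝ (powMap p x - powMap p y) (x - y) := by
  have hp0 : 0 < p := by linarith
  set f : E × E → ℝ := fun z => inner ℝ (powMap p z.1 - powMap p z.2) (z.1 - z.2) with hf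
  have hfc : Continuous f := by
    have := continuous_powMap (E := E) hp
    exact ((this.comp continuous_fst).sub (this.comp continuous_snd)).inner
      (continuous_fst.sub continuous_snd)
  have hnc : Continuous fun x : E => ‖x‖ ^ p := continuous_norm.rpow_const fun _ => Or.inr hp0.le
  -- By homogeneity it is enough to treat `‖x‖^p + ‖y‖^p = 1`. Off `S` the term `ε` suffices; on the
  -- compact set `S` the points differ, so the pairing has a positive lower bound `m`.
  set S : Set (E × E) := {z | ‖z.1‖ ^ p + ‖z.2‖ ^ p = 1 ∧ ε ≤ ‖z.1 - z.2‖ ^ p} with hS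
  have hle1 : ∀ x y : E, ‖x‖ ^ p + ‖y‖ ^ p = 1 → ‖x‖ ≤ 1 ∧ ‖y‖ ≤ 1 := by
    intro x y h
    have h1 : 0 ≤ ‖x‖ ^ p := by positivity
    have h2 : 0 ≤ ‖y‖ ^ p := by positivity
    constructor
    · rw [← Real.rpow_le_rpow_iff (norm_nonneg _) zero_le_one hp0, Real.one_rpow]; linarith
    · rw [← Real.rpow_le_rpow_iff (norm_nonneg _) zero_le_one hp0, Real.one_rpow]; linarith
  have hSc : IsCompact S := by
    refine Metric.isCompact_of_isClosed_isBounded ?_ ?_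
    · exact (isClosed_eq ((hnc.comp continuous_fst).add (hnc.comp continuous_snd))
        continuous_const).inter (isClosed_le continuous_const
          (hnc.comp (continuous_fst.sub continuous_snd)))
    · refine Bornology.IsBounded.subset (t := Metric.closedBall (0 : E × E) 1)
        Metric.isBounded_closedBall ?_
      intro z hz
      rw [mem_closedBall_zero_iff, Prod.norm_def]
      exact max_le (hle1 _ _ hz.1).1 (hle1 _ _ hz.1).2
  obtain ⟨m, hm, hmS⟩ : ∃ m > 0, ∀ z ∈ S, m ≤ f z := by
    rcases S.eq_empty_or_nonempty with h | h
    · exact ⟨1, one_pos, by simp [h]⟩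
    · obtain ⟨z, hz, hmin⟩ := hSc.exists_isMinOn h hfc.continuousOn
      refine ⟨f z, (inner_powMap_sub_nonneg_and_pos hp z.1 z.2).2 ?_, fun w hw => hmin hw⟩
      intro h
      have := hz.2
      rw [h, sub_self, norm_zero, Real.zero_rpow hp0.ne'] at this
      linarith
  -- Normalized pairs satisfy `‖x - y‖ ≤ 2`, so this multiple of a pairing at least `m` exceeds `‖x
  -- - y‖^p`.
  refine ⟨2 ^ p / m, by positivity, fun x y => ?_⟩
  -- the normalized inequality
  have hnorm : ∀ x y : E, ‖x‖ ^ p + ‖y‖ ^ p = 1 →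
      ‖x - y‖ ^ p ≤ ε + 2 ^ p / m * f (x, y) := by
    intro x y hxy
    have hf0 : 0 ≤ f (x, y) := inner_powMap_sub_nonneg hp x y
    by_cases h : ε ≤ ‖x - y‖ ^ p
    · have h1 := hmS (x, y) ⟨hxy, h⟩
      have h2 : ‖x - y‖ ^ p ≤ 2 ^ p := by
        refine Real.rpow_le_rpow (norm_nonneg _) ?_ hp0.le
        linarith [norm_sub_le x y, (hle1 x y hxy).1, (hle1 x y hxy).2]
      have h3 : 2 ^ p ≤ 2 ^ p / m * f (x, y) := by
        rw [div_mul_eq_mul_div, le_div_iff₀ hm]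
        gcongr
      linarith
    · have : 0 ≤ 2 ^ p / m * f (x, y) := by positivity
      linarith
  set s := ‖x‖ ^ p + ‖y‖ ^ p with hs
  have hs0 : 0 ≤ s := by positivity
  rcases hs0.eq_or_lt with h | h
  · have h1 : 0 ≤ ‖x‖ ^ p := by positivity
    have h2 : 0 ≤ ‖y‖ ^ p := by positivity
    have hx : x = 0 := by
      have : ‖x‖ ^ p = 0 := by linarith
      exact norm_eq_zero.1 ((Real.rpow_eq_zero (norm_nonneg _) hp0.ne').1 this)
    have hy : y = 0 := by
      have : ‖y‖ ^ p = 0 := by linarith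
      exact norm_eq_zero.1 ((Real.rpow_eq_zero (norm_nonneg _) hp0.ne').1 this)
    rw [← h, hx, hy]
    simp [Real.zero_rpow hp0.ne']
  · set t := s ^ (-(1 / p)) with ht
    have ht0 : 0 < t := Real.rpow_pos_of_pos h _
    have htp : t ^ p = s⁻¹ := by
      rw [ht, ← Real.rpow_mul h.le, neg_mul, one_div_mul_cancel hp0.ne', Real.rpow_neg_one]
    have hsc : ∀ v : E, ‖t • v‖ ^ p = s⁻¹ * ‖v‖ ^ p := by
      intro v
      rw [norm_smul, Real.norm_of_nonneg ht0.le, Real.mul_rpow ht0.le (norm_nonneg _), htp]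
    have h1 := hnorm (t • x) (t • y) (by rw [hsc, hsc, ← mul_add, ← hs, inv_mul_cancel₀ h.ne'])
    have hfs : f (t • x, t • y) = s⁻¹ * f (x, y) := by
      simp only [hf]
      rw [powMap_smul hp ht0.le, powMap_smul hp ht0.le, ← smul_sub, ← smul_sub,
        real_inner_smul_left, real_inner_smul_right, ← mul_assoc, rpow_sub_one_mul_self hp ht0.le,
        htp]
    rw [← smul_sub, hsc, hfs] at h1
    have h2 := mul_le_mul_of_nonneg_left h1 h.le
    have h3 : s * (s⁻¹ * ‖x - y‖ ^ p) = ‖x - y‖ ^ p := by field_simp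
    have h4 : s * (ε + 2 ^ p / m * (s⁻¹ * f (x, y))) = ε * s + 2 ^ p / m * f (x, y) := by
      field_simp
    rw [h3, h4] at h2
    exact h2

end DualityMap

/-! ### Power maps and Carathéodory functions as superposition operators -/

section Instances

variable {α : Type*} [MeasurableSpace α] {μ : Measure α}
  {E : Type*} [NormedAddCommGroup E] [InnerProductSpace ℝ E]
  {p p' : ℝ}

/-- Serves both halves of `τ`: `b = 1` for the gradient term and `b = β` for the boundary term. The
factor `p` makes it the gradient of `b‖x‖^p`. -/
theorem isNemytskii_powMap [hp : Fact (1 < p)] {b : α → ℝ} (hb : AEStronglyMeasurable b μ) {B : ℝ} (hB : 0 ≤ B)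
    (hbB : ∀ᵐ z ∂μ, |b z| ≤ B) :
    IsNemytskii μ p p' (fun z (x : E) => (p * b z) • powMap p x) where
  aestronglyMeasurable u hu :=
    (hb.const_mul p).smul ((continuous_powMap hp.out).comp_aestronglyMeasurable hu)
  continuous := Eventually.of_forall fun z => (continuous_powMap hp.out).const_smul _
  growth := by
    have hp0 : 0 < p := by linarith [hp.out]
    refine ⟨0, p * B, MemLp.zero, fun _ => le_rfl, by positivity, ?_⟩
    filter_upwards [hbB] with z hz x
    rw [norm_smul, norm_powMap hp.out, norm_mul, Real.norm_of_nonneg hp0.le, Real.norm_eq_abs,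
      Pi.zero_apply, zero_add]
    gcongr

theorem isPotential_powMap [hp : Fact (1 < p)] {b : α → ℝ} (hb : AEStronglyMeasurable b μ) :
    IsPotential μ (fun z (x : E) => (p * b z) • powMap p x) (fun z x => b z * ‖x‖ ^ p) where
  aestronglyMeasurable u hu := by
    have hp0 : 0 < p := by linarith [hp.out]
    exact hb.mul ((continuous_id.rpow_const fun _ => Or.inr hp0.le).comp_aestronglyMeasurable
      hu.norm)
  hasFDerivAt := Eventually.of_forall fun z x => by
    refine ((hasFDerivAt_norm_rpow x hp.out).const_mul (b z)).congr_fderiv ?_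
    ext w
    simp only [powMap, innerSL_apply_apply, real_inner_smul_left, smul_apply, smul_eq_mul]
    ring
  zero := Eventually.of_forall fun z => by
    have hp0 : 0 < p := by linarith [hp.out]
    simp [Real.zero_rpow hp0.ne']

/-- A Carathéodory function agrees, off a null set of parameters, with a jointly measurable one. -/
theorem exists_measurable_caratheodory {h : α → ℝ → ℝ} (hm : ∀ x, AEMeasurable (fun z => h z x) μ)
    (hc : ∀ᵐ z ∂μ, Continuous (h z)) :
    ∃ h' : α → ℝ → ℝ, Measurable (Function.uncurry h') ∧ (∀ z, Continuous (h' z)) ∧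
      ∀ᵐ z ∂μ, h' z = h z := by
  classical
  have hae : ∀ᵐ z ∂μ, Continuous (h z) ∧ ∀ r : ℚ, h z r = (hm r).mk _ z :=
    hc.and (ae_all_iff.2 fun r : ℚ => (hm r).ae_eq_mk)
  -- Agreement with measurable versions is imposed only at rationals, so the exceptional set stays
  -- null; continuity in `x` transfers measurability to all real arguments.
  set S := toMeasurable μ {z | ¬ (Continuous (h z) ∧ ∀ r : ℚ, h z r = (hm r).mk _ z)} with hS
  have hSm : MeasurableSet S := measurableSet_toMeasurable _ _
  have hS0 : μ S = 0 := by rw [hS, measure_toMeasurable]; exact hae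
  have hSc : ∀ z ∉ S, Continuous (h z) ∧ ∀ r : ℚ, h z r = (hm r).mk _ z := by
    intro z hz
    by_contra hcon
    exact hz (subset_toMeasurable μ _ hcon)
  set h' : α → ℝ → ℝ := fun z x => if z ∈ S then 0 else h z x with hh'
  have hcont : ∀ z, Continuous (h' z) := by
    intro z
    by_cases hz : z ∈ S
    · simpa [hh', hz] using continuous_const
    · simpa [hh', hz] using (hSc z hz).1
  have hrat : ∀ r : ℚ, Measurable fun z => h' z r := by
    intro r
    have : (fun z => h' z r) = fun z => if z ∈ S then 0 else (hm r).mk _ z := by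
      ext z
      by_cases hz : z ∈ S
      · simp [hh', hz]
      · simp [hh', hz, (hSc z hz).2 r]
    rw [this]
    exact Measurable.ite hSm measurable_const (hm r).measurable_mk
  have hmeas : ∀ x, Measurable fun z => h' z x := by
    intro x
    have hx : x ∈ closure (Set.range ((↑) : ℚ → ℝ)) := Rat.denseRange_cast x
    obtain ⟨r, hr, hrx⟩ := mem_closure_iff_seq_limit.1 hx
    choose r' hr' using hr
    refine measurable_of_tendsto_metrizable (f := fun n z => h' z (r n)) ?_ ?_
    · intro n
      rw [← hr' n]
      exact hrat _
    · rw [tendsto_pi_nhds]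
      intro z
      exact ((hcont z).tendsto x).comp hrx
  refine ⟨h', ?_, hcont, ?_⟩
  · exact (measurable_uncurry_of_continuous_of_measurable (u := fun x z => h' z x)
      hcont hmeas).comp measurable_swap
  · have : ∀ᵐ z ∂μ, z ∉ S := measure_eq_zero_iff_ae_notMem.1 hS0
    filter_upwards [this] with z hz
    ext x
    simp [hh', hz]

theorem isNemytskii_of_caratheodory [IsFiniteMeasure μ] {h : α → ℝ → ℝ}
    (hm : ∀ x, AEMeasurable (fun z => h z x) μ)
    (hc : ∀ᵐ z ∂μ, Continuous (h z)) {A C : ℝ} (hA : 0 ≤ A) (hC : 0 ≤ C)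
    (hg : ∀ᵐ z ∂μ, ∀ x, |h z x| ≤ A + C * |x| ^ (p - 1)) : IsNemytskii μ p p' h where
  aestronglyMeasurable u hu := by
    obtain ⟨h', hm', _, hae⟩ := exists_measurable_caratheodory hm hc
    have h1 : AEMeasurable (fun z => h' z (u z)) μ :=
      hm'.comp_aemeasurable (aemeasurable_id.prodMk hu.aemeasurable)
    refine h1.aestronglyMeasurable.congr ?_
    filter_upwards [hae] with z hz
    rw [hz]
  continuous := hc
  growth := ⟨fun _ => A, C, memLp_const _, fun _ => hA, hC, hg⟩

/-- The derivative is the fundamental theorem of calculus. For measurability, the primitive at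
`u(z)` is rewritten as `u(z) ∫₀¹ h(z, t u(z)) dt`, an integral over a fixed interval of a jointly
measurable function. -/
theorem isPotential_of_caratheodory {h : α → ℝ → ℝ}
    (hm : ∀ x, AEMeasurable (fun z => h z x) μ) (hc : ∀ᵐ z ∂μ, Continuous (h z)) :
    IsPotential μ h (fun z x => ∫ s in (0 : ℝ)..x, h z s) where
  aestronglyMeasurable u hu := by
    obtain ⟨h', hm', hc', hae⟩ := exists_measurable_caratheodory hm hc
    have hu' : Measurable (hu.mk u) := hu.stronglyMeasurable_mk.measurable
    have h1 : StronglyMeasurable fun z => ∫ t in Set.Ioc (0 : ℝ) 1, h' z (t * hu.mk u z) := by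
      have h2 : Measurable fun w : α × ℝ => h' w.1 (w.2 * hu.mk u w.1) :=
        hm'.comp (measurable_fst.prodMk (measurable_snd.mul (hu'.comp measurable_fst)))
      exact h2.stronglyMeasurable.integral_prod_right
    refine (hu.stronglyMeasurable_mk.mul h1).aestronglyMeasurable.congr ?_
    filter_upwards [hae, hu.ae_eq_mk] with z hz huz
    rw [← hz, huz]
    have h3 := intervalIntegral.smul_integral_comp_mul_right (a := 0) (b := 1) (h' z) (hu.mk u z)
    rw [zero_mul, one_mul] at h3
    rw [← h3, intervalIntegral.integral_of_le zero_le_one]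
    rfl
  hasFDerivAt := by
    filter_upwards [hc] with z hz x
    have h1 := (intervalIntegral.integral_hasDerivAt_right (hz.intervalIntegrable 0 x)
      (hz.stronglyMeasurableAtFilter _ _) hz.continuousAt).hasFDerivAt
    have e : ContinuousLinearMap.toSpanSingleton ℝ (h z x) = innerSL ℝ (h z x) := by
      ext
      simp
    exact e ▸ h1
  zero := Eventually.of_forall fun z => intervalIntegral.integral_same

end Instances

/-! ### Growth bounds and the combined nonlinearity -/

section Growth

variable {N : ℕ} {Ω : Set (Euc N)} {h : Euc N → ℝ → ℝ}

theorem LocallyBounded.exists_bound (hb : LocallyBounded Ω h) {ρ : ℝ} (hρ : 0 < ρ) :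
    ∃ A : ℝ, 0 ≤ A ∧ ∀ᵐ z ∂(vol Ω), ∀ x, |x| ≤ ρ → |h z x| ≤ A := by
  obtain ⟨a, ha, h1⟩ := hb ρ hρ
  refine ⟨(eLpNormEssSup a (vol Ω)).toReal, ENNReal.toReal_nonneg, ?_⟩
  have hfin : eLpNormEssSup a (vol Ω) ≠ ⊤ := by
    have := ha.eLpNorm_ne_top
    rwa [eLpNorm_exponent_top] at this
  filter_upwards [h1, enorm_ae_le_eLpNormEssSup a (vol Ω)] with z hz hz' x hx
  refine ((hz x hx).trans (le_abs_self _)).trans ?_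
  rw [← Real.norm_eq_abs, ← toReal_enorm]
  exact ENNReal.toReal_mono hfin hz'

/-- The limit controls large `|x|` and local boundedness the rest. The coefficient `|L| + ε` is kept
explicit because for `g`, where `L = 0`, it must be arbitrarily small. -/
theorem LimQuotAtInfty.exists_growth {r L : ℝ} (hr : 1 < r) (hb : LocallyBounded Ω h)
    (hl : LimQuotAtInfty Ω h r L) {ε : ℝ} (hε : 0 < ε) :
    ∃ A : ℝ, 0 ≤ A ∧ ∀ᵐ z ∂(vol Ω), ∀ x, |h z x| ≤ A + (|L| + ε) * |x| ^ (r - 1) := by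
  obtain ⟨M, hM, h1⟩ := hl ε hε
  obtain ⟨A, hA, h2⟩ := hb.exists_bound hM
  refine ⟨A, hA, ?_⟩
  filter_upwards [h1, h2] with z hz1 hz2 x
  have hpos : 0 ≤ |x| ^ (r - 1) := by positivity
  rcases le_total |x| M with hx | hx
  · have := hz2 x hx
    have : 0 ≤ (|L| + ε) * |x| ^ (r - 1) := by positivity
    linarith
  · have hx0 : 0 < |x| := hM.trans_le hx
    have h3 := hz1 x hx
    have h4 : |h z x / (|x| ^ (r - 2) * x)| ≤ |L| + ε := by
      have := abs_sub_abs_le_abs_sub (h z x / (|x| ^ (r - 2) * x)) L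
      linarith
    rw [abs_div, abs_mul, abs_of_nonneg (by positivity : 0 ≤ |x| ^ (r - 2)),
      rpow_sub_two_mul_self hr hx0.le, div_le_iff₀ (by positivity)] at h4
    linarith

theorem abs_primitive_le {z : Euc N} {r A C : ℝ} (hr : 1 < r) (hC : 0 ≤ C)
    (hg : ∀ x, |h z x| ≤ A + C * |x| ^ (r - 1)) (x : ℝ) :
    |primitive h z x| ≤ (A + C * |x| ^ (r - 1)) * |x| := by
  have := intervalIntegral.norm_integral_le_of_norm_le_const (f := h z) (a := 0) (b := x)
    (C := A + C * |x| ^ (r - 1)) ?_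
  · simpa [primitive] using this
  · intro s hs
    refine (hg s).trans ?_
    have hsx : |s| ≤ |x| := by
      rcases le_total 0 x with hx | hx
      · rw [Set.uIoc_of_le hx] at hs
        rw [abs_of_pos hs.1, abs_of_nonneg hx]; exact hs.2
      · rw [Set.uIoc_of_ge hx] at hs
        rw [abs_of_nonpos hs.2, abs_of_nonpos hx]; linarith [hs.1]
    have : |s| ^ (r - 1) ≤ |x| ^ (r - 1) :=
      Real.rpow_le_rpow (abs_nonneg _) hsx (by linarith)
    gcongr

theorem abs_mul_primitive_sub_le {z : Euc N} {p r A C : ℝ} (hp : 0 ≤ p) (hr : 1 < r) (hC : 0 ≤ C)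
    (hg : ∀ x, |h z x| ≤ A + C * |x| ^ (r - 1)) (x : ℝ) :
    |p * primitive h z x - h z x * x| ≤ (p + 1) * ((A + C * |x| ^ (r - 1)) * |x|) := by
  have h1 := abs_primitive_le hr hC hg x
  have h2 := mul_le_mul_of_nonneg_right (hg x) (abs_nonneg x)
  calc |p * primitive h z x - h z x * x| ≤ |p * primitive h z x| + |h z x * x| := abs_sub _ _
    _ = p * |primitive h z x| + |h z x| * |x| := by rw [abs_mul, abs_mul, abs_of_nonneg hp]
    _ ≤ p * ((A + C * |x| ^ (r - 1)) * |x|) + (A + C * |x| ^ (r - 1)) * |x| := by gcongr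
    _ = _ := by ring

/-- Beyond `X = (b/a)^(1/(q-1))` the term `a t^q` dominates `b t`; below it `b t ≤ b X`. -/
theorem exists_mul_le_rpow_add {q : ℝ} (hq : 1 < q) {a : ℝ} (ha : 0 < a) {b : ℝ} (hb : 0 ≤ b) :
    ∃ D, ∀ t : ℝ, 0 ≤ t → b * t ≤ a * t ^ q + D := by
  have hq1 : 0 < q - 1 := by linarith
  set X := (b / a) ^ (1 / (q - 1)) with hX
  refine ⟨b * X, fun t ht => ?_⟩
  rcases le_total t X with h | h
  · have h1 : 0 ≤ a * t ^ q := by positivity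
    have := mul_le_mul_of_nonneg_left h hb
    linarith
  · have h1 : b / a ≤ t ^ (q - 1) := by
      have h2 : X ^ (q - 1) = b / a := by
        rw [hX, ← Real.rpow_mul (by positivity), one_div_mul_cancel hq1.ne', Real.rpow_one]
      rw [← h2]
      exact Real.rpow_le_rpow (by positivity) h hq1.le
    have h2 : b ≤ a * t ^ (q - 1) := by
      rw [div_le_iff₀ ha] at h1; linarith
    have h3 := mul_le_mul_of_nonneg_right h2 ht
    rw [mul_assoc, rpow_sub_one_mul_self hq ht] at h3
    have : 0 ≤ b * X := by positivity
    linarith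

theorem rpow_le_one_add_rpow {a b t : ℝ} (ha : 0 ≤ a) (hab : a ≤ b) (ht : 0 ≤ t) :
    t ^ a ≤ 1 + t ^ b := by
  rcases le_total t 1 with h | h
  · have := Real.rpow_le_one ht h ha
    have : 0 ≤ t ^ b := by positivity
    linarith
  · have := Real.rpow_le_rpow_of_exponent_le h hab
    linarith

theorem primitive_add_const_mul {g f : Euc N → ℝ → ℝ} {z : Euc N} (hg : Continuous (g z))
    (hf : Continuous (f z)) (lam x : ℝ) :
    primitive (fun z x => lam * g z x + f z x) z x
      = lam * primitive g z x + primitive f z x := by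
  simp only [primitive]
  rw [intervalIntegral.integral_add ((hg.const_mul lam).intervalIntegrable _ _)
    (hf.intervalIntegrable _ _), intervalIntegral.integral_const_mul]

/-- The combined nonlinearity `λ g + f` grows at most like `|x|^{p-1}`, and
`p K(z,x) - k(z,x) x` dominates `|x|`. -/
theorem exists_combined_bounds {p q : ℝ} [hp : Fact (1 < p)] {β : Euc N → ℝ}
    {g f : Euc N → ℝ → ℝ} (hg : HypG Ω p q g) (hf : HypF Ω p β q f) {lam : ℝ} (hlam : 0 < lam) :
    (∃ A C : ℝ, 0 ≤ A ∧ 0 ≤ C ∧ ∀ᵐ z ∂(vol Ω), ∀ x, |g z x| ≤ A + C * |x| ^ (p - 1)) ∧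
    (∃ A C : ℝ, 0 ≤ A ∧ 0 ≤ C ∧ ∀ᵐ z ∂(vol Ω), ∀ x, |f z x| ≤ A + C * |x| ^ (p - 1)) ∧
    ∃ D : ℝ, ∀ᵐ z ∂(vol Ω), ∀ x, |x| ≤ p * primitive (fun z x => lam * g z x + f z x) z x
      - (lam * g z x + f z x) * x + D := by
  have hp1 := hp.out
  have hq1 := hg.one_lt
  have hqp := hg.lt_p
  obtain ⟨m, _, hlim⟩ := hf.limInfty
  obtain ⟨Af, hAf, hfg⟩ := hlim.exists_growth hp1 hf.locallyBounded one_pos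
  set Cf := |variationalEigenvalue Ω p β m| + 1 with hCf
  have hCf0 : 0 ≤ Cf := by positivity
  obtain ⟨c, hc, M, hM, hlow⟩ := hf.liminfInfty
  -- Chosen so that `λ(p+1)ε = c/2`: the `|x|^q` part of `λ(pG - gx)` uses up half of the
  -- coefficient `c` coming from `f`.
  set ε := c / (2 * (lam * (p + 1))) with hε
  have hε0 : 0 < ε := by positivity
  obtain ⟨Ag, hAg, hgg⟩ := hg.limInfty.exists_growth hq1 hg.locallyBounded hε0
  rw [abs_zero, zero_add] at hgg
  refine ⟨⟨Ag + ε, ε, by positivity, hε0.le, ?_⟩, ⟨Af, Cf, hAf, hCf0, hfg⟩, ?_⟩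
  · filter_upwards [hgg] with z hz x
    have h1 := rpow_le_one_add_rpow (a := q - 1) (b := p - 1) (by linarith) (by linarith)
      (abs_nonneg x)
    have := hz x
    have := mul_le_mul_of_nonneg_left h1 hε0.le
    linarith
  -- The other half of `c|x|^q` pays for the linear remainder of `g`; the extra `+ 1` is the `|x|`
  -- left over in the conclusion.
  obtain ⟨D₀, hD₀⟩ := exists_mul_le_rpow_add hq1 (half_pos hc)
    (by positivity : 0 ≤ lam * (p + 1) * Ag + 1)
  set D₁ := (p + 1) * ((Af + Cf * M ^ (p - 1)) * M) + c * M ^ q with hD₁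
  refine ⟨D₁ + D₀, ?_⟩
  filter_upwards [hgg, hfg, hlow, hg.caratheodory.2, hf.caratheodory.2]
    with z hzg hzf hzl hcg hcf x
  have hxq : 0 ≤ |x| ^ q := by positivity
  have h1 : c * |x| ^ q - D₁ ≤ p * primitive f z x - f z x * x := by
    rcases le_total M |x| with hx | hx
    · have h2 := hzl x hx
      have hx0 : 0 < |x| := hM.trans_le hx
      rw [le_div_iff₀ (by positivity)] at h2
      have : 0 ≤ D₁ := by positivity
      linarith
    · have h2 := abs_mul_primitive_sub_le (p := p) (by linarith) hp1 hCf0 hzf x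
      have h3 : (p + 1) * ((Af + Cf * |x| ^ (p - 1)) * |x|)
          ≤ (p + 1) * ((Af + Cf * M ^ (p - 1)) * M) := by
        have : |x| ^ (p - 1) ≤ M ^ (p - 1) :=
          Real.rpow_le_rpow (abs_nonneg _) hx (by linarith)
        have hp10 : 0 ≤ p + 1 := by linarith
        gcongr
      have h4 : c * |x| ^ q ≤ c * M ^ q :=
        mul_le_mul_of_nonneg_left (Real.rpow_le_rpow (abs_nonneg _) hx (by linarith)) hc.le
      have := (abs_le.1 h2).1
      linarith
  have h2 : - (lam * (p + 1) * Ag * |x| + c / 2 * |x| ^ q)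
      ≤ lam * (p * primitive g z x - g z x * x) := by
    have h3 := abs_mul_primitive_sub_le (p := p) (by linarith) hq1 hε0.le hzg x
    have h4 : (Ag + ε * |x| ^ (q - 1)) * |x| = Ag * |x| + ε * |x| ^ q := by
      rw [add_mul, mul_assoc, rpow_sub_one_mul_self hq1 (abs_nonneg x)]
    rw [h4] at h3
    have h5 := mul_le_mul_of_nonneg_left (abs_le.1 h3).1 hlam.le
    have h6 : lam * -((p + 1) * (Ag * |x| + ε * |x| ^ q))
        = - (lam * (p + 1) * Ag * |x| + c / 2 * |x| ^ q) := by
      rw [hε]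
      field_simp
    rwa [h6] at h5
  have h3 := hD₀ |x| (abs_nonneg x)
  rw [primitive_add_const_mul hcg hcf]
  linarith

end Growth

/-! ### Completeness of `W^{1,p}(Ω)` -/

section Completeness

variable {N : ℕ} {Ω : Set (Euc N)} {p : ℝ} [hp : Fact (1 < p)]

/-- For each test function and direction, being a weak gradient equates two continuous functionals,
given by Hölder pairings with compactly supported functions. -/
theorem isClosed_W1p : IsClosed (W1p Ω p : Set (WithLp (ENNReal.ofReal p)
    (Lp ℝ (ENNReal.ofReal p) (vol Ω) × Lp (Euc N) (ENNReal.ofReal p) (vol Ω)))) := by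
  have hconj : (ENNReal.conjExponent (ENNReal.ofReal p)).HolderConjugate (ENNReal.ofReal p) :=
    (ENNReal.HolderConjugate.conjExponent (factOneLe (p := p)).out).symm
  have : Fact (1 ≤ ENNReal.conjExponent (ENNReal.ofReal p)) :=
    ⟨ENNReal.HolderConjugate.one_le _ (ENNReal.ofReal p)⟩
  have hset : (W1p Ω p : Set (WithLp (ENNReal.ofReal p)
      (Lp ℝ (ENNReal.ofReal p) (vol Ω) × Lp (Euc N) (ENNReal.ofReal p) (vol Ω))))
      = ⋂ (φ : Euc N → ℝ) (_ : ContDiff ℝ ∞ φ) (_ : HasCompactSupport φ) (_ : tsupport φ ⊆ Ω)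
        (e : Euc N), {w | ∫ z in Ω, w.fst z * fderiv ℝ φ z e
          = - ∫ z in Ω, inner ℝ (w.snd z) e * φ z} := by
    ext w
    simp only [Set.mem_iInter, Set.mem_ofPred_eq]
    rfl
  rw [hset]
  refine isClosed_iInter fun φ => isClosed_iInter fun hφ => isClosed_iInter fun hc =>
    isClosed_iInter fun _ => isClosed_iInter fun e => ?_
  have m1 : MemLp (fun z => fderiv ℝ φ z e) (ENNReal.conjExponent (ENNReal.ofReal p)) (vol Ω) :=
    ((hφ.continuous_fderiv (by simp)).clm_apply continuous_const).memLp_of_hasCompactSupport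
      (hc.fderiv_apply (𝕜 := ℝ) e)
  have m2 : MemLp (fun z => φ z • e) (ENNReal.conjExponent (ENNReal.ofReal p)) (vol Ω) :=
    (hφ.continuous.smul continuous_const).memLp_of_hasCompactSupport hc.smul_right
  set ℓ₁ := (ContinuousLinearMap.mul ℝ ℝ).lpPairing (vol Ω)
    (ENNReal.conjExponent (ENNReal.ofReal p)) (ENNReal.ofReal p) m1.toLp with hℓ₁
  set ℓ₂ := (innerSL ℝ : Euc N →L[ℝ] Euc N →L[ℝ] ℝ).lpPairing (vol Ω)
    (ENNReal.conjExponent (ENNReal.ofReal p)) (ENNReal.ofReal p) m2.toLp with hℓ₂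
  have e1 : ∀ f : Lp ℝ (ENNReal.ofReal p) (vol Ω), ∫ z in Ω, f z * fderiv ℝ φ z e = ℓ₁ f := by
    intro f
    rw [hℓ₁, ContinuousLinearMap.lpPairing_eq_integral]
    apply integral_congr_ae
    filter_upwards [m1.coeFn_toLp] with z hz
    rw [hz, ContinuousLinearMap.mul_apply', mul_comm]
  have e2 : ∀ f : Lp (Euc N) (ENNReal.ofReal p) (vol Ω),
      ∫ z in Ω, inner ℝ (f z) e * φ z = ℓ₂ f := by
    intro f
    rw [hℓ₂, ContinuousLinearMap.lpPairing_eq_integral]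
    apply integral_congr_ae
    filter_upwards [m2.coeFn_toLp] with z hz
    rw [hz, innerSL_apply_apply, real_inner_smul_left, mul_comm, real_inner_comm]
  simp only [e1, e2]
  exact isClosed_eq
    (ℓ₁.continuous.comp (WithLp.fstL (ENNReal.ofReal p) ℝ (Lp ℝ (ENNReal.ofReal p) (vol Ω))
      (Lp (Euc N) (ENNReal.ofReal p) (vol Ω))).continuous)
    (ℓ₂.continuous.comp (WithLp.sndL (ENNReal.ofReal p) ℝ (Lp ℝ (ENNReal.ofReal p) (vol Ω))
      (Lp (Euc N) (ENNReal.ofReal p) (vol Ω))).continuous).neg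

instance completeSpace_W1p : CompleteSpace (W1p Ω p) := isClosed_W1p.completeSpace_coe

end Completeness

/-! ### A priori bounds in `W^{1,p}(Ω)` -/

section Boundedness

variable {N : ℕ} {Ω : Set (Euc N)} {p : ℝ} [hp : Fact (1 < p)]

theorem exists_integral_abs_le (hbdd : Bornology.IsBounded Ω) :
    ∃ c : ℝ, ∀ f : Lp ℝ (ENNReal.ofReal p) (vol Ω), ∫ z in Ω, |f z| ≤ c * ‖f‖ := by
  have : IsFiniteMeasure (vol Ω) := ⟨by simpa using hbdd.measure_lt_top⟩
  set t : ℝ := 1 / (1 : ℝ≥0∞).toReal - 1 / (ENNReal.ofReal p).toReal with ht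
  have ht0 : 0 ≤ t := by
    rw [ht, toReal_ofReal_exponent, ENNReal.toReal_one, div_one, sub_nonneg,
      div_le_one (by linarith [hp.out])]
    exact hp.out.le
  refine ⟨((vol Ω Set.univ) ^ t).toReal, fun f => ?_⟩
  have h1 := eLpNorm_le_eLpNorm_mul_rpow_measure_univ (factOneLe (p := p)).out
    (Lp.aestronglyMeasurable f)
  have h2 : ∫ z in Ω, |f z| = (eLpNorm f 1 (vol Ω)).toReal := by
    rw [eLpNorm_one_eq_lintegral_enorm, ← integral_norm_eq_lintegral_enorm (Lp.aestronglyMeasurable f)]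
    rfl
  rw [h2, Lp.norm_def, mul_comm, ← ENNReal.toReal_mul]
  refine ENNReal.toReal_mono (ENNReal.mul_ne_top (Lp.eLpNorm_ne_top f) ?_) h1
  exact ENNReal.rpow_ne_top_of_nonneg ht0 (measure_ne_top _ _)

theorem integrable_Lp (hbdd : Bornology.IsBounded Ω) {F : Type*} [NormedAddCommGroup F]
    (f : Lp F (ENNReal.ofReal p) (vol Ω)) : Integrable f (vol Ω) := by
  have : IsFiniteMeasure (vol Ω) := ⟨by simpa using hbdd.measure_lt_top⟩
  exact (Lp.memLp f).integrable factOneLe.out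

/-- On a bounded set the `L¹` norm is controlled by the `Lᵖ` norm, so the limit has vanishing `L¹`
norm. -/
theorem eq_zero_of_tendsto (hbdd : Bornology.IsBounded Ω)
    {f : ℕ → Lp ℝ (ENNReal.ofReal p) (vol Ω)} {y : Lp ℝ (ENNReal.ofReal p) (vol Ω)}
    (hf : Tendsto f atTop (𝓝 y)) (hf0 : Tendsto (fun n => ∫ z in Ω, |f n z|) atTop (𝓝 0)) :
    y = 0 := by
  obtain ⟨c, hc⟩ := exists_integral_abs_le (p := p) hbdd
  have h1 : ∀ n, ∫ z in Ω, |y z| ≤ c * ‖y - f n‖ + ∫ z in Ω, |f n z| := by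
    intro n
    have e : ∫ z in Ω, |y z| ≤ ∫ z in Ω, (|(y - f n) z| + |f n z|) := by
      refine integral_mono_ae (integrable_Lp hbdd y).abs
        ((integrable_Lp hbdd (y - f n)).abs.add (integrable_Lp hbdd (f n)).abs) ?_
      filter_upwards [Lp.coeFn_sub y (f n)] with z hz
      rw [hz, Pi.sub_apply]
      simpa using abs_add_le (y z - f n z) (f n z)
    rw [integral_add (integrable_Lp hbdd (y - f n)).abs (integrable_Lp hbdd (f n)).abs] at e
    linarith [hc (y - f n)]
  have h2 : Tendsto (fun n => c * ‖y - f n‖ + ∫ z in Ω, |f n z|) atTop (𝓝 0) := by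
    have := ((tendsto_const_nhds.sub hf : Tendsto (fun n => y - f n) atTop (𝓝 (y - y))).norm.const_mul
      c).add hf0
    simpa using this
  have h3 : ∫ z in Ω, |y z| ≤ 0 := ge_of_tendsto' h2 h1
  have h4 : ∫ z in Ω, |y z| = 0 := le_antisymm h3 (integral_nonneg fun _ => abs_nonneg _)
  rw [integral_eq_zero_iff_of_nonneg (fun _ => abs_nonneg _) (integrable_Lp hbdd y).abs] at h4
  rw [Lp.eq_zero_iff_ae_eq_zero]
  filter_upwards [h4] with z hz
  simpa using hz

theorem fn_smul (c : ℝ) (u : W1p Ω p) : fn (c • u) = c • fn u := (fnL (Ω := Ω) (p := p)).map_smul c u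
theorem grad_smul (c : ℝ) (u : W1p Ω p) : grad (c • u) = c • grad u :=
  (gradL (Ω := Ω) (p := p)).map_smul c u
theorem fn_sub (u w : W1p Ω p) : fn (u - w) = fn u - fn w := (fnL (Ω := Ω) (p := p)).map_sub u w
theorem grad_sub (u w : W1p Ω p) : grad (u - w) = grad u - grad w :=
  (gradL (Ω := Ω) (p := p)).map_sub u w

/-- A bound in `L¹` and a bound of the gradient by the function in `Lᵖ` give a bound in
`W^{1,p}`. -/
theorem exists_norm_le_of_grad_le (hΩ : IsOpen Ω) (hbdd : Bornology.IsBounded Ω)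
    (hbdry : HasC2Boundary Ω) (M₁ M₂ C : ℝ) :
    ∃ R : ℝ, ∀ u : W1p Ω p, ∫ z in Ω, |fn u z| ≤ M₁ →
      ‖grad u‖ ^ p ≤ M₂ + C * ‖fn u‖ ^ p → ‖u‖ ≤ R := by
  have hp0 : 0 < p := by linarith [hp.out]
  by_contra! hcon
  choose u hu1 hu2 hun using fun n : ℕ => hcon (n + 1)
  have hpos : ∀ n, 0 < ‖u n‖ := fun n => lt_trans (by positivity) (hun n)
  set y : ℕ → W1p Ω p := fun n => ‖u n‖⁻¹ • u n with hy
  have hy1 : ∀ n, ‖y n‖ = 1 := fun n => by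
    rw [hy]
    simp only
    rw [norm_smul, norm_inv, norm_norm, inv_mul_cancel₀ (hpos n).ne']
  have hinv : Tendsto (fun n => ‖u n‖⁻¹) atTop (𝓝 0) := by
    refine tendsto_inv_atTop_zero.comp (tendsto_atTop_mono (fun n => ?_) tendsto_natCast_atTop_atTop)
    linarith [hun n]
  obtain ⟨k, hk, w, hw⟩ := exists_subseq_tendsto_fn (p := p) hΩ hbdd hbdry (fun n => (hy1 n).le)
  have hinvk := hinv.comp hk.tendsto_atTop
  have hfny : ∀ n, fn (y n) = ‖u n‖⁻¹ • fn (u n) := fun n => fn_smul _ _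
  have hw0 : w = 0 := by
    refine eq_zero_of_tendsto hbdd hw ?_
    have hle : ∀ n, ∫ z in Ω, |fn (y (k n)) z| ≤ ‖u (k n)‖⁻¹ * M₁ := by
      intro n
      have e : ∫ z in Ω, |fn (y (k n)) z| = ‖u (k n)‖⁻¹ * ∫ z in Ω, |fn (u (k n)) z| := by
        rw [← integral_const_mul]
        apply integral_congr_ae
        rw [hfny]
        filter_upwards [Lp.coeFn_smul ‖u (k n)‖⁻¹ (fn (u (k n)))] with z hz
        rw [hz, Pi.smul_apply, smul_eq_mul, abs_mul, abs_of_pos (inv_pos.2 (hpos _))]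
      rw [e]
      exact mul_le_mul_of_nonneg_left (hu1 _) (inv_pos.2 (hpos _)).le
    refine squeeze_zero (fun n => integral_nonneg fun _ => abs_nonneg _) hle ?_
    simpa using hinvk.mul_const M₁
  subst hw0
  have hfn0 : Tendsto (fun n => ‖fn (y (k n))‖ ^ p) atTop (𝓝 0) := by
    have := hw.norm.rpow_const (p := p) (Or.inr hp0.le)
    simpa [Real.zero_rpow hp0.ne'] using this
  have hgrad : ∀ n, ‖grad (y n)‖ ^ p ≤ (‖u n‖⁻¹) ^ p * M₂ + C * ‖fn (y n)‖ ^ p := by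
    intro n
    have hi : 0 ≤ ‖u n‖⁻¹ := (inv_pos.2 (hpos n)).le
    have e1 : ‖grad (y n)‖ ^ p = (‖u n‖⁻¹) ^ p * ‖grad (u n)‖ ^ p := by
      rw [hy]
      simp only
      rw [grad_smul, norm_smul, Real.norm_of_nonneg hi, Real.mul_rpow hi (norm_nonneg _)]
    have e2 : ‖fn (y n)‖ ^ p = (‖u n‖⁻¹) ^ p * ‖fn (u n)‖ ^ p := by
      rw [hfny, norm_smul, Real.norm_of_nonneg hi, Real.mul_rpow hi (norm_nonneg _)]
    rw [e1, e2]
    have := mul_le_mul_of_nonneg_left (hu2 n) (by positivity : 0 ≤ (‖u n‖⁻¹) ^ p)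
    linarith
  -- The identity `1 = ‖yₙ‖^p = ‖yₙ‖ₚ^p + ‖Dyₙ‖^p` is bounded by a quantity that tends to zero.
  have hone : ∀ n, 1 ≤ ‖fn (y (k n))‖ ^ p
      + ((‖u (k n)‖⁻¹) ^ p * M₂ + C * ‖fn (y (k n))‖ ^ p) := by
    intro n
    have h1 := norm_rpow_eq (y (k n))
    rw [hy1, Real.one_rpow] at h1
    linarith [hgrad (k n)]
  have hlim : Tendsto (fun n => ‖fn (y (k n))‖ ^ p
      + ((‖u (k n)‖⁻¹) ^ p * M₂ + C * ‖fn (y (k n))‖ ^ p)) atTop (𝓝 0) := by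
    have h1 : Tendsto (fun n => (‖u (k n)‖⁻¹) ^ p) atTop (𝓝 0) := by
      have := hinvk.rpow_const (p := p) (Or.inr hp0.le)
      simpa [Real.zero_rpow hp0.ne'] using! this
    simpa using hfn0.add ((h1.mul_const M₂).add (hfn0.const_mul C))
  have := ge_of_tendsto' hlim hone
  linarith

end Boundedness

/-! ### Derivative of the energy and the Cerami condition -/

section Energy

variable {N : ℕ} {Ω : Set (Euc N)} {p : ℝ} [hp : Fact (1 < p)]

theorem HypBeta.bounds (hbdd : Bornology.IsBounded Ω) {β : Euc N → ℝ} (hβ : HypBeta Ω β) :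
    AEStronglyMeasurable β (surf Ω) ∧ (∃ B : ℝ, 0 ≤ B ∧ ∀ᵐ z ∂(surf Ω), |β z| ≤ B) ∧
      ∀ᵐ z ∂(surf Ω), 0 ≤ β z := by
  obtain ⟨⟨a, ha, _, C, hC⟩, hpos⟩ := hβ
  have hcont : ContinuousOn β (frontier Ω) := hC.continuousOn ha
  have hm : MeasurableSet (frontier Ω) := isClosed_frontier.measurableSet
  have hc : IsCompact (frontier Ω) :=
    hbdd.isCompact_closure.of_isClosed_subset isClosed_frontier frontier_subset_closure
  refine ⟨hcont.aestronglyMeasurable hm, ?_, ?_⟩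
  · obtain ⟨B, hB⟩ := hc.exists_bound_of_continuousOn hcont
    refine ⟨max B 0, le_max_right _ _, ?_⟩
    filter_upwards [ae_restrict_mem hm] with z hz
    exact (hB z hz).trans (le_max_left _ _)
  · filter_upwards [ae_restrict_mem hm] with z hz using (hpos z hz).le

theorem integral_norm_rpow {α F : Type*} [MeasurableSpace α] {μ : Measure α}
    [NormedAddCommGroup F] (f : Lp F (ENNReal.ofReal p) μ) :
    ∫ z, ‖f z‖ ^ p ∂μ = ‖f‖ ^ p := by
  have hp0 : 0 < p := by linarith [hp.out]
  rw [integral_eq_lintegral_of_nonneg_ae (Eventually.of_forall fun _ => by positivity)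
    ((Lp.aestronglyMeasurable f).norm.aemeasurable.pow_const p).aestronglyMeasurable]
  have h : ∀ z, ENNReal.ofReal (‖f z‖ ^ p) = ‖f z‖ₑ ^ p := fun z => by
    rw [← ofReal_norm, ENNReal.ofReal_rpow_of_nonneg (norm_nonneg _) hp0.le]
  simp only [h]
  rw [lintegral_enorm_rpow, ← ENNReal.toReal_rpow, toReal_enorm]

theorem integrable_inner_powMap {α F : Type*} [MeasurableSpace α] {μ : Measure α}
    [NormedAddCommGroup F] [InnerProductSpace ℝ F] {f g : α → F}
    (hf : MemLp f (ENNReal.ofReal p) μ) (hg : MemLp g (ENNReal.ofReal p) μ) :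
    Integrable (fun z => inner ℝ (powMap p (f z)) (g z)) μ := by
  have hpp := Real.HolderConjugate.conjExponent hp.out
  refine (memLp_integrable_mul hpp (memLp_norm_rpow_sub_one hpp hf) hg.norm).mono'
    (((continuous_powMap hp.out).comp_aestronglyMeasurable hf.1).inner hg.1)
    (Eventually.of_forall fun z => ?_)
  rw [← norm_powMap hp.out]
  exact norm_inner_le_norm _ _

theorem integrable_norm_rpow {α F : Type*} [MeasurableSpace α] {μ : Measure α}
    [NormedAddCommGroup F] (f : Lp F (ENNReal.ofReal p) μ) :
    Integrable (fun z => ‖f z‖ ^ p) μ := by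
  have hp0 : 0 < p := by linarith [hp.out]
  have := (Lp.memLp f).integrable_norm_rpow (by simpa using hp0) (by simp)
  rwa [toReal_ofReal_exponent] at this

/-- The form `⟨A(u), w⟩ + ∫_{∂Ω} β |u|^{p-2} u w dσ`. -/
noncomputable def robinForm (β : Euc N → ℝ) (u w : W1p Ω p) : ℝ :=
  (∫ z in Ω, inner ℝ (powMap p (grad u z)) (grad w z))
    + ∫ z, β z * inner ℝ (powMap p (trace Ω p u z)) (trace Ω p w z) ∂(surf Ω)

theorem robinForm_self (β : Euc N → ℝ) (u : W1p Ω p) : robinForm β u u = tau β u := by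
  rw [robinForm, tau, ← integral_norm_rpow]
  simp only [inner_powMap_self hp.out, Real.norm_eq_abs]

/-- The energy is continuously differentiable. -/
theorem exists_deriv_energy (hbdd : Bornology.IsBounded Ω) {β : Euc N → ℝ} (hβ : HypBeta Ω β)
    {k : Euc N → ℝ → ℝ} (hk : IsCaratheodory Ω k) {A C : ℝ} (hA : 0 ≤ A) (hC : 0 ≤ C)
    (hg : ∀ᵐ z ∂(vol Ω), ∀ x, |k z x| ≤ A + C * |x| ^ (p - 1)) :
    ∃ (E' : W1p Ω p → W1p Ω p →L[ℝ] ℝ)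
      (D : Lp ℝ (ENNReal.ofReal p) (vol Ω) → Lp ℝ (ENNReal.ofReal p) (vol Ω) →L[ℝ] ℝ),
      Continuous E' ∧ Continuous D ∧
      (∀ u, HasFDerivAt
        (fun u : W1p Ω p => 1 / p * tau β u - ∫ z in Ω, primitive k z (fn u z)) (E' u) u) ∧
      (∀ u w, D u w = ∫ z in Ω, k z (u z) * w z) ∧
      ∀ u w, E' u w = robinForm β u w - D (fn u) (fn w) := by
  have hp0 : 0 < p := by linarith [hp.out]
  have hfin : IsFiniteMeasure (vol Ω) := ⟨by simpa using hbdd.measure_lt_top⟩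
  have hpp := Real.HolderConjugate.conjExponent hp.out
  have : Fact (1 < p.conjExponent) := ⟨hpp.symm.lt⟩
  obtain ⟨hβm, ⟨B, hB, hβB⟩, _⟩ := hβ.bounds hbdd
  obtain ⟨D₁, hD₁c, hD₁e, hD₁d⟩ := (isPotential_powMap (μ := vol Ω) (E := Euc N) (p := p)
    (aestronglyMeasurable_const (b := (1 : ℝ)))).contDiff
    (isNemytskii_powMap aestronglyMeasurable_const zero_le_one
      (Eventually.of_forall fun _ => by simp)) hpp
  obtain ⟨D₂, hD₂c, hD₂e, hD₂d⟩ := (isPotential_powMap (E := ℝ) (p := p) hβm).contDiff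
    (isNemytskii_powMap hβm hB hβB) hpp
  obtain ⟨D₃, hD₃c, hD₃e, hD₃d⟩ := (isPotential_of_caratheodory hk.1 hk.2).contDiff
    (isNemytskii_of_caratheodory (p := p) hk.1 hk.2 hA hC hg) hpp
  refine ⟨fun u => (1 / p) • ((D₁ (grad u)).comp gradL + (D₂ (trace Ω p u)).comp (trace Ω p))
    - (D₃ (fn u)).comp fnL, D₃, ?_, hD₃c, fun u => ?_, ?_, ?_⟩
  · have c1 : Continuous fun u : W1p Ω p => (D₁ (grad u)).comp gradL :=
      (hD₁c.comp gradL.continuous).clm_comp continuous_const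
    have c2 : Continuous fun u : W1p Ω p => (D₂ (trace Ω p u)).comp (trace Ω p) :=
      (hD₂c.comp (trace Ω p).continuous).clm_comp continuous_const
    have c3 : Continuous fun u : W1p Ω p => (D₃ (fn u)).comp fnL :=
      (hD₃c.comp fnL.continuous).clm_comp continuous_const
    have c12 : Continuous fun u : W1p Ω p => (D₁ (grad u)).comp gradL
        + (D₂ (trace Ω p u)).comp (trace Ω p) := c1.add c2
    have c4 : Continuous fun u : W1p Ω p => (1 / p) • ((D₁ (grad u)).comp gradL
        + (D₂ (trace Ω p u)).comp (trace Ω p)) := Continuous.const_smul c12 (1 / p)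
    exact c4.sub c3
  · have d1 := (hD₁d (grad u)).comp u (gradL (Ω := Ω) (p := p)).hasFDerivAt
    have d2 := (hD₂d (trace Ω p u)).comp u (trace Ω p).hasFDerivAt
    have d3 := (hD₃d (fn u)).comp u (fnL (Ω := Ω) (p := p)).hasFDerivAt
    have d := ((d1.add d2).const_mul (1 / p)).sub d3
    refine d.congr_of_eventuallyEq (Eventually.of_forall fun v => ?_)
    simp only [Pi.add_apply, Pi.sub_apply, Function.comp_apply, one_mul,
      integral_norm_rpow, tau, Real.norm_eq_abs, primitive]
  · intro u w
    rw [hD₃e]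
    exact integral_congr_ae (Eventually.of_forall fun z => by
      simp [mul_comm])
  · intro u w
    have e1 : D₁ (grad u) (grad w)
        = p * ∫ z in Ω, inner ℝ (powMap p (grad u z)) (grad w z) := by
      rw [hD₁e, ← integral_const_mul]
      simp only [mul_one, real_inner_smul_left]
    have e2 : D₂ (trace Ω p u) (trace Ω p w) = p * ∫ z, β z *
        inner ℝ (powMap p (trace Ω p u z)) (trace Ω p w z) ∂(surf Ω) := by
      rw [hD₂e, ← integral_const_mul]
      simp only [real_inner_smul_left, mul_assoc]
    simp only [sub_apply, smul_apply, add_apply, ContinuousLinearMap.comp_apply, gradL_apply,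
      fnL_apply, smul_eq_mul]
    rw [e1, e2, robinForm]
    field_simp

/-- A criterion for the Cerami condition in terms of the derivative. -/
theorem CeramiCondition.of_hasFDerivAt {X : Type*} [NormedAddCommGroup X] [NormedSpace ℝ X]
    [CompleteSpace X] {φ : X → ℝ} {φ' : X → X →L[ℝ] ℝ} (hc : Continuous φ')
    (hd : ∀ u, HasFDerivAt φ (φ' u) u)
    (h : ∀ u : ℕ → X, (∃ M : ℝ, ∀ n, |φ (u n)| ≤ M) → ∀ δ : ℕ → ℝ, Tendsto δ atTop (𝓝 0) →
      (∀ n, 0 ≤ δ n) → (∀ n, |φ' (u n) (u n)| ≤ δ n) → (∀ n w, |φ' (u n) w| ≤ δ n * ‖w‖) →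
      ∃ k : ℕ → ℕ, StrictMono k ∧ CauchySeq fun n => u (k n)) : CeramiCondition φ := by
  refine ⟨contDiff_one_iff_hasFDerivAt.2 ⟨φ', hc, hd⟩, fun u hM hcer => ?_⟩
  -- One null sequence serves both estimates: the summand `‖u n‖` of the weight controls `φ'(uₙ)uₙ`,
  -- the summand `1` controls `φ'(uₙ)` on arbitrary directions.
  have hδ0 : Tendsto (fun n => ‖(1 + ‖u n‖) • φ' (u n)‖) atTop (𝓝 0) := by
    simpa [(hd _).fderiv] using hcer.norm
  have hle : ∀ n, (1 + ‖u n‖) * ‖φ' (u n)‖ = ‖(1 + ‖u n‖) • φ' (u n)‖ := fun n => by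
    rw [norm_smul, Real.norm_of_nonneg (by positivity)]
  have h1 : ∀ n, |φ' (u n) (u n)| ≤ ‖(1 + ‖u n‖) • φ' (u n)‖ := fun n => by
    rw [← hle, ← Real.norm_eq_abs]
    refine ((φ' (u n)).le_opNorm _).trans ?_
    have := norm_nonneg (φ' (u n))
    linarith
  have h2 : ∀ n w, |φ' (u n) w| ≤ ‖(1 + ‖u n‖) • φ' (u n)‖ * ‖w‖ := fun n w => by
    rw [← hle, ← Real.norm_eq_abs]
    refine ((φ' (u n)).le_opNorm _).trans (mul_le_mul_of_nonneg_right ?_ (norm_nonneg _))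
    exact le_mul_of_one_le_left (norm_nonneg _) (by linarith [norm_nonneg (u n)])
  obtain ⟨k, hk, hC⟩ := h u hM _ hδ0 (fun n => norm_nonneg _) h1 h2
  exact ⟨k, hk, cauchySeq_tendsto_of_complete hC⟩

theorem integrable_inner_powMap_sub {α F : Type*} [MeasurableSpace α] {μ : Measure α}
    [NormedAddCommGroup F] [InnerProductSpace ℝ F] (f g : Lp F (ENNReal.ofReal p) μ) :
    Integrable (fun z => inner ℝ (powMap p (f z) - powMap p (g z)) (f z - g z)) μ := by
  have m := (Lp.memLp f).sub (Lp.memLp g)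
  refine ((integrable_inner_powMap (Lp.memLp f) m).sub
    (integrable_inner_powMap (Lp.memLp g) m)).congr (Eventually.of_forall fun z => ?_)
  simp only [Pi.sub_apply, inner_sub_left]

/-- The discarded boundary contribution is nonnegative, by monotonicity of the power map and `β ≥
0`. -/
theorem integral_inner_powMap_sub_le {β : Euc N → ℝ} (hβm : AEStronglyMeasurable β (surf Ω))
    {B : ℝ} (hβB : ∀ᵐ z ∂(surf Ω), |β z| ≤ B) (hβ0 : ∀ᵐ z ∂(surf Ω), 0 ≤ β z) (v w : W1p Ω p) :
    ∫ z in Ω, inner ℝ (powMap p (grad v z) - powMap p (grad w z)) (grad v z - grad w z)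
      ≤ robinForm β v (v - w) - robinForm β w (v - w) := by
  have i1 : ∀ a b : W1p Ω p,
      Integrable (fun z => inner ℝ (powMap p (grad a z)) (grad b z)) (vol Ω) := fun a b =>
    integrable_inner_powMap (Lp.memLp _) (Lp.memLp _)
  have i2 : ∀ a b : W1p Ω p, Integrable (fun z => β z *
      inner ℝ (powMap p (trace Ω p a z)) (trace Ω p b z)) (surf Ω) := fun a b =>
    (integrable_inner_powMap (Lp.memLp _) (Lp.memLp _)).bdd_mul hβm hβB
  have e1 : ∫ z in Ω, inner ℝ (powMap p (grad v z) - powMap p (grad w z))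
      (grad v z - grad w z)
      = (∫ z in Ω, inner ℝ (powMap p (grad v z)) (grad (v - w) z))
        - ∫ z in Ω, inner ℝ (powMap p (grad w z)) (grad (v - w) z) := by
    rw [← integral_sub (i1 _ _) (i1 _ _)]
    apply integral_congr_ae
    rw [grad_sub]
    filter_upwards [Lp.coeFn_sub (grad v) (grad w)] with z hz
    rw [hz, Pi.sub_apply, inner_sub_left]
  have e2 : 0 ≤ (∫ z, β z * inner ℝ (powMap p (trace Ω p v z)) (trace Ω p (v - w) z) ∂(surf Ω))
        - ∫ z, β z * inner ℝ (powMap p (trace Ω p w z)) (trace Ω p (v - w) z) ∂(surf Ω) := by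
    rw [← integral_sub (i2 _ _) (i2 _ _)]
    apply integral_nonneg_of_ae
    rw [map_sub]
    filter_upwards [Lp.coeFn_sub (trace Ω p v) (trace Ω p w), hβ0] with z hz hz0
    rw [hz, Pi.sub_apply, ← mul_sub, ← inner_sub_left]
    exact mul_nonneg hz0 (inner_powMap_sub_nonneg hp.out _ _)
  rw [e1, robinForm, robinForm]
  linarith

/-- Smallness of the monotone difference of `|f|^{p-2} f` forces smallness of the difference in
`Lᵖ`, on bounded sets. -/
theorem exists_norm_sub_rpow_le_integral {α F : Type*} [MeasurableSpace α] {μ : Measure α}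
    [NormedAddCommGroup F] [InnerProductSpace ℝ F] [FiniteDimensional ℝ F] {ε : ℝ} (hε : 0 < ε) :
    ∃ c : ℝ, 0 ≤ c ∧ ∀ f g : Lp F (ENNReal.ofReal p) μ,
      ‖f - g‖ ^ p ≤ ε * (‖f‖ ^ p + ‖g‖ ^ p)
        + c * ∫ z, inner ℝ (powMap p (f z) - powMap p (g z)) (f z - g z) ∂μ := by
  obtain ⟨c, hc, hcE⟩ := exists_norm_sub_rpow_le (E := F) hp.out hε
  refine ⟨c, hc, fun f g => ?_⟩
  have imon := integrable_inner_powMap_sub f g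
  have h1 : ‖f - g‖ ^ p ≤ ∫ z, (ε * (‖f z‖ ^ p + ‖g z‖ ^ p)
      + c * inner ℝ (powMap p (f z) - powMap p (g z)) (f z - g z)) ∂μ := by
    rw [← integral_norm_rpow]
    refine integral_mono_ae (integrable_norm_rpow _)
      ((((integrable_norm_rpow f).add (integrable_norm_rpow g)).const_mul ε).add
        (imon.const_mul c)) ?_
    filter_upwards [Lp.coeFn_sub f g] with z hz
    rw [hz, Pi.sub_apply]
    exact hcE _ _
  have h2 : ∫ z, ε * (‖f z‖ ^ p + ‖g z‖ ^ p) ∂μ = ε * (‖f‖ ^ p + ‖g‖ ^ p) := by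
    rw [integral_const_mul, integral_add (integrable_norm_rpow f) (integrable_norm_rpow g),
      integral_norm_rpow, integral_norm_rpow]
  have h3 : ∫ z, (ε * (‖f z‖ ^ p + ‖g z‖ ^ p)
      + c * inner ℝ (powMap p (f z) - powMap p (g z)) (f z - g z)) ∂μ
      = (∫ z, ε * (‖f z‖ ^ p + ‖g z‖ ^ p) ∂μ)
        + c * ∫ z, inner ℝ (powMap p (f z) - powMap p (g z)) (f z - g z) ∂μ := by
    rw [← integral_const_mul]
    exact integral_add (((integrable_norm_rpow f).add (integrable_norm_rpow g)).const_mul ε)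
      (imon.const_mul c)
  rwa [h3, h2] at h1

/-- The `(S)₊` property of the `p`-Laplacian in Cauchy form: no weak limit has to be identified,
since vanishing of the monotone differences over pairs of indices makes the gradients Cauchy. -/
theorem cauchySeq_of_tendsto_fn_of_tendsto_monotone {x : ℕ → W1p Ω p} {R : ℝ}
    (hR : ∀ n, ‖x n‖ ≤ R) (hfn : CauchySeq fun n => fn (x n)) {J : ℕ × ℕ → ℝ}
    (hJ0 : Tendsto J atTop (𝓝 0))
    (hJ : ∀ n, ∫ z in Ω, inner ℝ (powMap p (grad (x n.1) z) - powMap p (grad (x n.2) z))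
      (grad (x n.1) z - grad (x n.2) z) ≤ J n) : CauchySeq x := by
  have hp0 : 0 < p := by linarith [hp.out]
  have hR0 : 0 ≤ R := (norm_nonneg _).trans (hR 0)
  have hfnC : Tendsto (fun n : ℕ × ℕ => ‖fn (x n.1) - fn (x n.2)‖) atTop (𝓝 0) := by
    simpa [dist_eq_norm] using cauchySeq_iff_tendsto_dist_atTop_0.1 hfn
  have hgradC : Tendsto (fun n : ℕ × ℕ => ‖grad (x n.1) - grad (x n.2)‖ ^ p) atTop (𝓝 0) := by
    rw [tendsto_order]
    refine ⟨fun a ha => Eventually.of_forall fun n => ha.trans_le (by positivity), fun ε hε => ?_⟩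
    -- Makes `η` times the two gradient norms, at most `2R^p` together, no larger than `ε/2`; the `+
    -- 1` keeps the denominator positive when `R = 0`.
    set η := ε / (2 * (2 * R ^ p + 1)) with hη
    have hRp : 0 ≤ R ^ p := by positivity
    have hη0 : 0 < η := by positivity
    obtain ⟨c, hc, hcE⟩ := exists_norm_sub_rpow_le_integral (p := p) (F := Euc N) (μ := vol Ω) hη0
    have hcJ : Tendsto (fun n => c * J n) atTop (𝓝 0) := by simpa using hJ0.const_mul c
    filter_upwards [hcJ.eventually (gt_mem_nhds (half_pos hε))] with n hn
    have h1 := hcE (grad (x n.1)) (grad (x n.2))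
    have h3 : ∀ m, ‖grad (x m)‖ ^ p ≤ R ^ p := fun m =>
      Real.rpow_le_rpow (norm_nonneg _) ((norm_grad_le _).trans (hR m)) hp0.le
    have h5 : η * (‖grad (x n.1)‖ ^ p + ‖grad (x n.2)‖ ^ p) ≤ ε / 2 := by
      have e : η * (2 * R ^ p + 1) = ε / 2 := by
        rw [hη]; field_simp
      rw [← e]
      exact mul_le_mul_of_nonneg_left (by linarith [h3 n.1, h3 n.2]) hη0.le
    have h6 := mul_le_mul_of_nonneg_left (hJ n) hc
    linarith
  rw [cauchySeq_iff_tendsto_dist_atTop_0]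
  have hsum : Tendsto (fun n : ℕ × ℕ => dist (x n.1) (x n.2) ^ p) atTop (𝓝 0) := by
    have h1 := hfnC.rpow_const (p := p) (Or.inr hp0.le)
    rw [Real.zero_rpow hp0.ne'] at h1
    have h2 := h1.add hgradC
    rw [add_zero] at h2
    refine h2.congr fun n => ?_
    rw [dist_eq_norm, norm_rpow_eq, fn_sub, grad_sub]
  have h3 := hsum.rpow_const (p := 1 / p) (Or.inr (by positivity))
  rw [Real.zero_rpow (by positivity)] at h3
  refine h3.congr fun n => ?_
  rw [← Real.rpow_mul dist_nonneg, mul_one_div_cancel hp0.ne', Real.rpow_one]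

/-- The Cerami condition for a Robin energy whose nonlinearity `k` grows at most like `|x|^{p-1}`
and is such that `p K(z,x) - k(z,x) x` dominates `|x|`. -/
theorem ceramiCondition_of_bounds (hΩ : IsOpen Ω) (hbdd : Bornology.IsBounded Ω)
    (hbdry : HasC2Boundary Ω) {β : Euc N → ℝ} (hβ : HypBeta Ω β)
    {k : Euc N → ℝ → ℝ} (hk : IsCaratheodory Ω k) {A C : ℝ} (hA : 0 ≤ A) (hC : 0 ≤ C)
    (hg : ∀ᵐ z ∂(vol Ω), ∀ x, |k z x| ≤ A + C * |x| ^ (p - 1)) {D₀ : ℝ}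
    (hlow : ∀ᵐ z ∂(vol Ω), ∀ x, |x| ≤ p * primitive k z x - k z x * x + D₀) :
    CeramiCondition
      (fun u : W1p Ω p => 1 / p * tau β u - ∫ z in Ω, primitive k z (fn u z)) := by
  have hp0 : 0 < p := by linarith [hp.out]
  have hfin : IsFiniteMeasure (vol Ω) := ⟨by simpa using hbdd.measure_lt_top⟩
  have hpp := Real.HolderConjugate.conjExponent hp.out
  have : Fact (1 < p.conjExponent) := ⟨hpp.symm.lt⟩
  obtain ⟨hβm, ⟨B, hB, hβB⟩, hβ0⟩ := hβ.bounds hbdd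
  obtain ⟨E', D, hE'c, hDc, hE', hD, hE'e⟩ := exists_deriv_energy (p := p) hbdd hβ hk hA hC hg
  refine CeramiCondition.of_hasFDerivAt hE'c hE' fun u hM δ hδ hδ0 hδu hδw => ?_
  obtain ⟨M, hM⟩ := hM
  have hkN : IsNemytskii (vol Ω) p p.conjExponent k :=
    isNemytskii_of_caratheodory (p := p) hk.1 hk.2 hA hC hg
  have hkint : ∀ v : W1p Ω p, Integrable (fun z => k z (fn v z) * fn v z) (vol Ω) := fun v =>
    memLp_integrable_mul hpp (hkN.memLp hpp (Lp.memLp (fn v))) (Lp.memLp (fn v))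
  have hKint : ∀ v : W1p Ω p, Integrable (fun z => primitive k z (fn v z)) (vol Ω) := fun v =>
    (isPotential_of_caratheodory hk.1 hk.2).integrable hkN hpp (Lp.memLp (fn v))
  have htest : ∀ v : W1p Ω p, E' v v = tau β v - ∫ z in Ω, k z (fn v z) * fn v z := by
    intro v
    rw [hE'e, hD, robinForm_self]
  have htau : ∀ v : W1p Ω p, ‖grad v‖ ^ p ≤ tau β v := by
    intro v
    have : 0 ≤ ∫ z, β z * |trace Ω p v z| ^ p ∂(surf Ω) := by
      apply integral_nonneg_of_ae
      filter_upwards [hβ0] with z hz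
      exact mul_nonneg hz (by positivity)
    rw [tau]
    linarith
  -- boundedness of the sequence
  obtain ⟨M₁, hM₁⟩ := hδ.bddAbove_range
  have hEu : ∀ n, |E' (u n) (u n)| ≤ M₁ := fun n =>
    (hδu n).trans (hM₁ (Set.mem_range_self n))
  set V : ℝ := (vol Ω).real Set.univ with hV
  -- From `∫(pK - ku) = φ'(u)u - pφ(u)`, in which `τ(u)` has cancelled.
  have hL1 : ∀ n, ∫ z in Ω, |fn (u n) z| ≤ M₁ + p * M + D₀ * V := by
    intro n
    have h1 : ∫ z in Ω, |fn (u n) z| ≤ ∫ z in Ω, (p * primitive k z (fn (u n) z)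
        - k z (fn (u n) z) * fn (u n) z + D₀) := by
      refine integral_mono_ae (integrable_Lp hbdd _).abs
        ((((hKint _).const_mul p).sub (hkint _)).add (integrable_const _)) ?_
      filter_upwards [hlow] with z hz using hz _
    have h2 : ∫ z in Ω, (p * primitive k z (fn (u n) z)
        - k z (fn (u n) z) * fn (u n) z + D₀)
        = (p * (∫ z in Ω, primitive k z (fn (u n) z)) - ∫ z in Ω, k z (fn (u n) z) * fn (u n) z)
          + D₀ * V := by
      rw [← integral_const_mul, ← integral_sub ((hKint _).const_mul p) (hkint _),
        integral_add (f := fun z => p * primitive k z (fn (u n) z)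
          - k z (fn (u n) z) * fn (u n) z) (((hKint _).const_mul p).sub (hkint _))
          (integrable_const _), integral_const, smul_eq_mul, mul_comm D₀]
    have h3 := htest (u n)
    have h4 := (abs_le.1 (hM n)).1
    have h5 := (abs_le.1 (hEu n)).2
    have h6 : p * (1 / p * tau β (u n) - ∫ z in Ω, primitive k z (fn (u n) z))
        = tau β (u n) - p * ∫ z in Ω, primitive k z (fn (u n) z) := by
      field_simp
    have h7 := mul_le_mul_of_nonneg_left h4 hp0.le
    rw [h6] at h7
    linarith
  -- Here `‖Du‖^p ≤ τ(u) = φ'(u)u + ∫ku`; the growth bound splits the last integral into an `L¹`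
  -- part, already controlled, and `C‖u‖ₚ^p`.
  have hgrad : ∀ n, ‖grad (u n)‖ ^ p
      ≤ (M₁ + A * (M₁ + p * M + D₀ * V)) + C * ‖fn (u n)‖ ^ p := by
    intro n
    have h1 : ∫ z in Ω, k z (fn (u n) z) * fn (u n) z
        ≤ ∫ z in Ω, (A * |fn (u n) z| + C * ‖fn (u n) z‖ ^ p) := by
      refine integral_mono_ae (hkint _) (((integrable_Lp hbdd _).abs.const_mul A).add
        ((integrable_norm_rpow (fn (u n))).const_mul C)) ?_
      filter_upwards [hg] with z hz
      have h2 := mul_le_mul_of_nonneg_right (hz (fn (u n) z)) (abs_nonneg (fn (u n) z))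
      rw [add_mul, mul_assoc, rpow_sub_one_mul_self hp.out (abs_nonneg _), ← abs_mul] at h2
      exact (le_abs_self _).trans h2
    rw [integral_add ((integrable_Lp hbdd _).abs.const_mul A)
      ((integrable_norm_rpow (fn (u n))).const_mul C), integral_const_mul, integral_const_mul,
      integral_norm_rpow] at h1
    have h2 := htest (u n)
    have h3 := (abs_le.1 (hEu n)).2
    have h4 := htau (u n)
    have h5 := mul_le_mul_of_nonneg_left (hL1 n) hA
    linarith
  obtain ⟨R, hR⟩ := exists_norm_le_of_grad_le (p := p) hΩ hbdd hbdry (M₁ + p * M + D₀ * V)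
    (M₁ + A * (M₁ + p * M + D₀ * V)) C
  have huR : ∀ n, ‖u n‖ ≤ R := fun n => hR (u n) (hL1 n) (hgrad n)
  have hR0 : 0 ≤ R := (norm_nonneg _).trans (huR 0)
  -- extraction of a subsequence converging in `Lᵖ(Ω)`
  obtain ⟨κ, hκ, y, hy⟩ := exists_subseq_tendsto_fn (p := p) hΩ hbdd hbdry huR
  refine ⟨κ, hκ, cauchySeq_of_tendsto_fn_of_tendsto_monotone
    -- The first summand bounds the derivatives tested with `uₙ - uₘ`, of norm at most `2R`; the
    -- second bounds the difference of the nonlinear terms, where `D` is continuous and the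
    -- functions converge in `Lᵖ`.
    (J := fun n => (δ (κ n.1) + δ (κ n.2)) * (2 * R)
      + ‖D (fn (u (κ n.1))) - D (fn (u (κ n.2)))‖ * ‖fn (u (κ n.1)) - fn (u (κ n.2))‖)
    (fun n => huR _) hy.cauchySeq ?_ fun n => ?_⟩
  · have hfnC : Tendsto (fun n : ℕ × ℕ => ‖fn (u (κ n.1)) - fn (u (κ n.2))‖) atTop (𝓝 0) := by
      simpa [dist_eq_norm] using cauchySeq_iff_tendsto_dist_atTop_0.1 hy.cauchySeq
    have hDC : Tendsto (fun n : ℕ × ℕ => ‖D (fn (u (κ n.1))) - D (fn (u (κ n.2)))‖) atTop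
        (𝓝 0) := by
      have := ((hDc.tendsto y).comp hy).cauchySeq
      simpa [dist_eq_norm] using cauchySeq_iff_tendsto_dist_atTop_0.1 this
    have hδκ := hδ.comp hκ.tendsto_atTop
    rw [← prod_atTop_atTop_eq] at hfnC hDC ⊢
    have h1 := ((hδκ.comp tendsto_fst).add (hδκ.comp tendsto_snd)).mul_const (2 * R)
    simpa using h1.add (hDC.mul hfnC)
  · set v := u (κ n.1) with hv
    set w := u (κ n.2) with hw
    have hvw : ‖v - w‖ ≤ 2 * R := by
      linarith [norm_sub_le v w, huR (κ n.1), huR (κ n.2)]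
    have b1 : E' v (v - w) ≤ δ (κ n.1) * (2 * R) :=
      (le_abs_self _).trans ((hδw _ _).trans (mul_le_mul_of_nonneg_left hvw (hδ0 _)))
    have b2 : - E' w (v - w) ≤ δ (κ n.2) * (2 * R) :=
      (neg_le_abs _).trans ((hδw _ _).trans (mul_le_mul_of_nonneg_left hvw (hδ0 _)))
    have b3 : D (fn v) (fn (v - w)) - D (fn w) (fn (v - w))
        ≤ ‖D (fn v) - D (fn w)‖ * ‖fn v - fn w‖ := by
      rw [← sub_apply, fn_sub]
      exact (le_abs_self _).trans ((D (fn v) - D (fn w)).le_opNorm _)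
    have b4 := integral_inner_powMap_sub_le hβm hβB hβ0 v w
    rw [hE'e] at b1 b2
    linarith

end Energy

end RobinResonant

theorem proposition13 {N : ℕ} (hN : 1 ≤ N)
    (Ω : Set (RobinResonant.Euc N)) (hopen : IsOpen Ω) (hconn : IsConnected Ω)
    (hbdd : Bornology.IsBounded Ω) (hbdry : RobinResonant.HasC2Boundary Ω)
    (p : ℝ) [Fact (1 < p)]
    (β : RobinResonant.Euc N → ℝ) (hβ : RobinResonant.HypBeta Ω β)
    (q : ℝ) (g f : RobinResonant.Euc N → ℝ → ℝ)
    (hg : RobinResonant.HypG Ω p q g) (hf : RobinResonant.HypF Ω p β q f)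
    (lam : ℝ) (hlam : 0 < lam) :
    RobinResonant.CeramiCondition
      (RobinResonant.energy (Ω := Ω) (p := p) β g f lam) := by
  have hp := Fact.out (p := 1 < p)
  have hpp := Real.HolderConjugate.conjExponent hp
  have hfin : MeasureTheory.IsFiniteMeasure (RobinResonant.vol Ω) :=
    ⟨by simpa using hbdd.measure_lt_top⟩
  obtain ⟨⟨Ag, Cg, hAg, hCg, hgg⟩, ⟨Af, Cf, hAf, hCf, hfg⟩, D, hD⟩ :=
    RobinResonant.exists_combined_bounds hg hf hlam
  have hk : RobinResonant.IsCaratheodory Ω (fun z x => lam * g z x + f z x) := by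
    refine ⟨fun x => ((hg.caratheodory.1 x).const_mul lam).add (hf.caratheodory.1 x), ?_⟩
    filter_upwards [hg.caratheodory.2, hf.caratheodory.2] with z h1 h2
    exact (h1.const_mul lam).add h2
  have hkg : ∀ᵐ z ∂(RobinResonant.vol Ω), ∀ x, |lam * g z x + f z x|
      ≤ (lam * Ag + Af) + (lam * Cg + Cf) * |x| ^ (p - 1) := by
    filter_upwards [hgg, hfg] with z h1 h2 x
    have h3 := mul_le_mul_of_nonneg_left (h1 x) hlam.le
    have h4 := abs_add_le (lam * g z x) (f z x)
    rw [abs_mul, abs_of_pos hlam] at h4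
    linarith [h2 x]
  have hcer := RobinResonant.ceramiCondition_of_bounds (p := p) hopen hbdd hbdry hβ hk
    (by positivity) (by positivity) hkg hD
  -- Separate integrability of the two primitives is needed to split the integral of the primitive
  -- of `λg + f` into the two terms of the energy.
  have hGi : ∀ u : RobinResonant.W1p Ω p, MeasureTheory.Integrable
      (fun z => RobinResonant.primitive g z (RobinResonant.fn u z)) (RobinResonant.vol Ω) :=
    fun u => (RobinResonant.isPotential_of_caratheodory hg.caratheodory.1
      hg.caratheodory.2).integrable (RobinResonant.isNemytskii_of_caratheodory (p := p)
        hg.caratheodory.1 hg.caratheodory.2 hAg hCg hgg) hpp (MeasureTheory.Lp.memLp _)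
  have hFi : ∀ u : RobinResonant.W1p Ω p, MeasureTheory.Integrable
      (fun z => RobinResonant.primitive f z (RobinResonant.fn u z)) (RobinResonant.vol Ω) :=
    fun u => (RobinResonant.isPotential_of_caratheodory hf.caratheodory.1
      hf.caratheodory.2).integrable (RobinResonant.isNemytskii_of_caratheodory (p := p)
        hf.caratheodory.1 hf.caratheodory.2 hAf hCf hfg) hpp (MeasureTheory.Lp.memLp _)
  convert hcer using 1
  ext u
  have h : ∫ z in Ω, RobinResonant.primitive (fun z x => lam * g z x + f z x) z
        (RobinResonant.fn u z)
      = ∫ z in Ω, (lam * RobinResonant.primitive g z (RobinResonant.fn u z)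
        + RobinResonant.primitive f z (RobinResonant.fn u z)) := by
    apply MeasureTheory.integral_congr_ae
    filter_upwards [hg.caratheodory.2, hf.caratheodory.2] with z h1 h2
    exact RobinResonant.primitive_add_const_mul h1 h2 lam _
  rw [h, MeasureTheory.integral_add ((hGi u).const_mul lam) (hFi u),
    MeasureTheory.integral_const_mul, RobinResonant.energy]
  ring
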